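/- Consider $n$ processes, each of which repeatedly calls arbitrary methods of one shared concurrent object $\mathcal{O}$ with arbitrary arguments. $\llbracket \mathcal{O},n\rrbracket$ is the resulting labelled transition system, with initial configuration $q_0$; its labels are call actions $call(P,m,a)$, return actions $return(P,m,b)$ and internal steps. Write $\llbracket \mathcal{O}_1,n\rrbracket \preceq_{(c,r)} \llbracket \mathcal{O}_2,n\rrbracket$ if there is a forward simulation, i.e. a relation $R$ between configurations that relates the initial configurations and is such that, whenever $(c_1,c_2)\in R$ and $c_1\xrightarrow{\alpha}c_1'$, there is a finite path $c_2\xrightarrow{\ell}c_2'$ with $(c_1',c_2')\in R$ such that $\alpha$ and $\ell$ have the same sequence of call and return actions. The Herlihy–Wing queue $\mathcal{O}_{HWQ}$ has an unbounded array $Q$, with all entries initially $\bot$, and a variable $X$, initially $1$. $enq(v)$, for $v\in\mathbb{N}$, performs the atomic steps $i:=getAndInc(X)$; $Q[i]:=v$; return $ack$. $deq()$ repeats rounds: it reads $l:=X$; if $l=1$ it starts a new round; otherwise it performs $x:=swap(Q[j],\bot)$ for $j=1,\dots,l-1$ in turn and returns $x$ as soon as $x\neq\bot$; if no such $x$ is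 found it starts a new round. $Queue$ is the sequential specification of the FIFO queue of natural numbers: $enq(v)\Rightarrow ack$ is always possible, $deq()\Rightarrow v$ is possible if $v$ is the front element, and $deq()\Rightarrow empty$ if the queue is empty. The universal object $\mathcal{U}_{Queue}$ executes a call of $m$ with argument $a$ by process $pid$ as follows. Shared data are a generator of unique identities, a history recorder, arrays $announce[\,]$ and $head[\,]$ with one entry per process, and nodes with fields $oid,m,a,hist,lin,decideNext$ (a consensus object), $seq,next$. A new node has $seq=0$ and null $hist,lin,next$. Initially all array entries point to a sentinel node $tail$ with $seq=1$ that carries no operation. (i) Get a fresh identity $oid$ and append $call(pid,m,a)$, tagged with $oid$, to the recorded history. Set $announce[pid]$ to a new node for $(oid,m,a)$ and $head[pid]$ to a node of maximal $seq$ among the entries of $head[\,]$. (ii) While $announce[pid].seq=0$: let $before:=head[pid]$ and $help:=announce[(before.seq+1)\bmod n]$; let $prefer:=help$ if $help.seq=0$, and $prefer:=announce[pid]$ otherwise; let $after:=before.decideNext.decide(prefer)$; read the recorded history $h_1$ and execute $cas(after.hist,null,h_1)$; choose nondeterministically a linearization $l$ of $after.hist$ with respect to $Queue$ that contains the operation of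 $after$ and, for each non-sentinel node in the list from $tail$ to $before$, the operation of that node with the same return value as in the $lin$-field of that node; execute $cas(after.lin,null,l)$; set $before.next:=after$, $after.seq:=before.seq+1$, $head[pid]:=after$. (iii) Set $head[pid]:=announce[pid]$; let $b$ be the return value of the operation $oid$ in the $lin$-field of its node in the list; append $return(pid,m,b)$, tagged with $oid$, to the recorded history; return $b$. **Theorem.** For every number $n$ of processes, the Herlihy–Wing queue is forward-simulated by $\mathcal{U}_{Queue}$: $$\llbracket \mathcal{O}_{HWQ},n\rrbracket \preceq_{(c,r)} \llbracket \mathcal{U}_{Queue},n\rrbracket .$$ -/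

import Mathlib

namespace HWSim

/-! ### Labelled transition systems and forward simulation -/

/-- A labelled transition system with transition labels in `Lab`. -/
structure LTS (Lab : Type) where
  State : Type
  step : State → Lab → State → Prop
  init : State

/-- `A.Path c ls c'`: a finite transition sequence from `c` to `c'` with labels `ls`. -/
inductive LTS.Path {Lab : Type} (A : LTS Lab) : A.State → List Lab → A.State → Prop
  | nil (c : A.State) : LTS.Path A c [] c
  | cons {c c' c'' : A.State} {l : Lab} {ls : List Lab} :
      A.step c l c' → LTS.Path A c' ls c'' → LTS.Path A c (l :: ls) c''

/-- The finite traces of an LTS: label sequences of paths from the initial state. -/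
def LTS.traces {Lab : Type} (A : LTS Lab) : Set (List Lab) :=
  {t | ∃ c, A.Path A.init t c}

/-- `R` is a forward simulation from `A₁` to `A₂`, where `vis` maps a label to the visible action
it carries, and to `none` if it is internal. -/
structure IsForwardSim {Lab Vis : Type} (vis : Lab → Option Vis) (A₁ A₂ : LTS Lab)
    (R : A₁.State → A₂.State → Prop) : Prop where
  init : R A₁.init A₂.init
  step : ∀ c₁ c₂ α c₁', R c₁ c₂ → A₁.step c₁ α c₁' →
    ∃ ls c₂', A₂.Path c₂ ls c₂' ∧ ls.filterMap vis = [α].filterMap vis ∧ R c₁' c₂'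

/-! ### Objects, actions, and the operational semantics under most general clients -/

/-- The interface of an object: methods, the arguments of each method, return values. -/
structure Sig where
  Method : Type
  Arg : Method → Type
  Ret : Type

/-- An invocation `(m, a)`. -/
abbrev Sig.Inv (S : Sig) : Type := (m : S.Method) × S.Arg m

/-- An operation `m(a) ⇒ b`. -/
structure Operation (S : Sig) where
  inv : S.Inv
  ret : S.Ret

/-- Call actions `call(P, m, a)` and return actions `return(P, m, b)` of `n` processes. -/
inductive Action (S : Sig) (n : ℕ) where
  | call (p : Fin n) (inv : S.Inv)
  | ret (p : Fin n) (m : S.Method) (b : S.Ret)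

/-- The process of an action. -/
def Action.pid {S : Sig} {n : ℕ} : Action S n → Fin n
  | .call p _ => p
  | .ret p _ _ => p

/-- Transition labels: call and return actions, and internal steps of a process. -/
inductive Label (S : Sig) (n : ℕ) where
  | act (α : Action S n)
  | internal (p : Fin n)

/-- Call and return actions are visible, all other labels are internal. -/
def Label.visible {S : Sig} {n : ℕ} : Label S n → Option (Action S n)
  | .act α => some α
  | .internal _ => none

/-- A concurrent object for `n` processes: a shared memory, and the local states (control point and
local variables) of a method execution. `entry inv` is the local state right after the call of
`inv`; `step p inv` are the atomic steps of process `p` while it executes `inv`; `result ℓ` is the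
value about to be returned if `ℓ` is at a return statement. -/
structure ConcObj (S : Sig) (n : ℕ) where
  Shared : Type
  Loc : Type
  init : Shared
  entry : S.Inv → Loc
  step : Fin n → S.Inv → Shared → Loc → Shared → Loc → Prop
  result : Loc → Option S.Ret

/-- A configuration: the shared memory and, for each process, either `none` (no pending call) or
the pending invocation with its local state. -/
structure ConcObj.Config {S : Sig} {n : ℕ} (O : ConcObj S n) where
  mem : O.Shared
  proc : Fin n → Option (S.Inv × O.Loc)

/-- Transitions of `n` processes, each running a most general client of `O`: an idle process may
call any method with any argument, a busy one executes its method until it returns. -/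
inductive ConcObj.Step {S : Sig} {n : ℕ} (O : ConcObj S n) :
    O.Config → Label S n → O.Config → Prop
  | call (c : O.Config) (p : Fin n) (inv : S.Inv) :
      c.proc p = none →
      ConcObj.Step O c (.act (.call p inv))
        ⟨c.mem, Function.update c.proc p (some (inv, O.entry inv))⟩
  | internal (c : O.Config) (p : Fin n) (inv : S.Inv) (ℓ ℓ' : O.Loc) (μ' : O.Shared) :
      c.proc p = some (inv, ℓ) →
      O.step p inv c.mem ℓ μ' ℓ' →
      ConcObj.Step O c (.internal p) ⟨μ', Function.update c.proc p (some (inv, ℓ'))⟩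
  | ret (c : O.Config) (p : Fin n) (inv : S.Inv) (ℓ : O.Loc) (b : S.Ret) :
      c.proc p = some (inv, ℓ) →
      O.result ℓ = some b →
      ConcObj.Step O c (.act (.ret p inv.1 b)) ⟨c.mem, Function.update c.proc p none⟩

/-- The operational semantics `⟦O, n⟧`. -/
def ConcObj.sem {S : Sig} {n : ℕ} (O : ConcObj S n) : LTS (Label S n) where
  State := O.Config
  step := O.Step
  init := ⟨O.init, fun _ => none⟩

/-- `⟦O₁, n⟧ ⪯_(c,r) ⟦O₂, n⟧`: there is a forward simulation for which exactly the call and return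
actions are visible. -/
def SimulatedBy {S : Sig} {n : ℕ} (O₁ O₂ : ConcObj S n) : Prop :=
  ∃ R : O₁.sem.State → O₂.sem.State → Prop, IsForwardSim Label.visible O₁.sem O₂.sem R

/-! ### Histories and linearizations

The actions of a recorded history carry the identity of their operation. -/

/-- An action together with the identity of its operation. -/
structure Event (S : Sig) (n : ℕ) where
  act : Action S n
  oid : ℕ

/-- A completed operation of a process, with its operation identity. -/
structure TaggedOp (S : Sig) (n : ℕ) where
  pid : Fin n
  oid : ℕ
  op : Operation S

def TaggedOp.callEvent {S : Sig} {n : ℕ} (x : TaggedOp S n) : Event S n :=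
  ⟨.call x.pid x.op.inv, x.oid⟩

def TaggedOp.retEvent {S : Sig} {n : ℕ} (x : TaggedOp S n) : Event S n :=
  ⟨.ret x.pid x.op.inv.1 x.op.ret, x.oid⟩

/-- The sequential history of a sequence of operations. -/
def toHistory {S : Sig} {n : ℕ} (l : List (TaggedOp S n)) : List (Event S n) :=
  l.flatMap fun x => [x.callEvent, x.retEvent]

/-- The event `e` belongs to a pair of a call and a later matching return of `h`. -/
def Matched {S : Sig} {n : ℕ} (h : List (Event S n)) (e : Event S n) : Prop :=
  ∃ x : TaggedOp S n, (e = x.callEvent ∨ e = x.retEvent) ∧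
    List.Sublist [x.callEvent, x.retEvent] h

open Classical in
/-- The subsequence of all the matching call and return actions of `h`. -/
noncomputable def complete {S : Sig} {n : ℕ} (h : List (Event S n)) : List (Event S n) :=
  h.filter fun e => decide (Matched h e)

/-- The process subhistory of `p`. -/
def procHistory {S : Sig} {n : ℕ} (h : List (Event S n)) (p : Fin n) : List (Event S n) :=
  h.filter fun e => decide (e.act.pid = p)

/-- Two histories are equivalent if they have the same process subhistories. -/
def HistEquiv {S : Sig} {n : ℕ} (h h' : List (Event S n)) : Prop :=
  ∀ p, procHistory h p = procHistory h' p

/-- The happen-before relation of `h`: the return of `o₁` occurs before the call of `o₂`. -/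
def HappensBefore {S : Sig} {n : ℕ} (h : List (Event S n)) (o₁ o₂ : ℕ) : Prop :=
  ∃ p₁ m b p₂ inv, List.Sublist [⟨.ret p₁ m b, o₁⟩, ⟨.call p₂ inv, o₂⟩] h

/-- The sequence `l` of operations is a linearization of the history `h` with respect to the
sequential specification `Spec`: some extension of `h` by return actions, restricted to its
matching actions, is equivalent to the sequential history of `l`, the underlying sequence of `l` is
in `Spec`, and the happen-before order of `h` is kept. -/
def IsLinearization {S : Sig} {n : ℕ} (Spec : Set (List (Operation S)))
    (h : List (Event S n)) (l : List (TaggedOp S n)) : Prop :=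
  l.map TaggedOp.op ∈ Spec ∧
  (∃ rs : List (Event S n), (∀ e ∈ rs, ∃ p m b, e.act = .ret p m b) ∧
    HistEquiv (complete (h ++ rs)) (toHistory l)) ∧
  ∀ x ∈ l, ∀ y ∈ l, HappensBefore h x.oid y.oid → HappensBefore (toHistory l) x.oid y.oid

/-! ### The universal object -/

/-- Nodes of the linked list. `none` stands for null. The field `op` holds the operation identity,
the method and the argument; it is `none` only for the sentinel at the tail of the list.
`decideNext` is the state of the consensus object: the decided node, if any. -/
structure Node (S : Sig) (n : ℕ) where
  op : Option (ℕ × S.Inv)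
  hist : Option (List (Event S n))
  lin : Option (List (TaggedOp S n))
  decideNext : Option ℕ
  seq : ℕ
  next : Option ℕ

/-- A new node: all fields but the operation are null, the sequence number is `0`. -/
def Node.new {S : Sig} {n : ℕ} (op : Option (ℕ × S.Inv)) : Node S n :=
  ⟨op, none, none, none, 0, none⟩

/-- Shared memory: the identity generator (next unused identity), the content of the history
recorder, the heap of nodes with the next unused address, and the two arrays. -/
structure UMem (S : Sig) (n : ℕ) where
  nextId : ℕ
  his : List (Event S n)
  heap : ℕ → Node S n
  nextAddr : ℕ
  announce : Fin n → ℕ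
  head : Fin n → ℕ

/-- The address of the sentinel. -/
def tailAddr : ℕ := 0

/-- Initially the list consists of the sentinel, which has sequence number `1` and to which all
entries of both arrays point. -/
def UMem.init (S : Sig) (n : ℕ) : UMem S n where
  nextId := 0
  his := []
  heap := fun a => if a = tailAddr then { Node.new none with seq := 1 } else Node.new none
  nextAddr := tailAddr + 1
  announce := fun _ => tailAddr
  head := fun _ => tailAddr

/-- Overwrite the node at address `a`. -/
def UMem.set {S : Sig} {n : ℕ} (μ : UMem S n) (a : ℕ) (nd : Node S n) : UMem S n :=
  { μ with heap := Function.update μ.heap a nd }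

/-- The node `b` can be reached from the node `a` along `next`. -/
def UMem.Reach {S : Sig} {n : ℕ} (μ : UMem S n) (a b : ℕ) : Prop :=
  Relation.ReflTransGen (fun x y => (μ.heap x).next = some y) a b

/-- The operation `oid` is in the sequence `l`, with return value `b`. -/
def HasRet {S : Sig} {n : ℕ} (l : List (TaggedOp S n)) (oid : ℕ) (b : S.Ret) : Prop :=
  ∃ x ∈ l, x.oid = oid ∧ x.op.ret = b

/-- The possible results of `genLin()` when the node `aft` is to be appended after `bef`: the
linearizations of the `hist`-field of `aft` that contain the operation of `aft` and, with the return
value given by the `lin`-field of its node, the operation of each node that is already in the list,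
i.e. of each node from the tail to `bef`. -/
def GenLin {S : Sig} {n : ℕ} (Spec : Set (List (Operation S))) (μ : UMem S n) (bef aft : ℕ)
    (l : List (TaggedOp S n)) : Prop :=
  (∃ h, (μ.heap aft).hist = some h ∧ IsLinearization Spec h l) ∧
  (∃ oid inv b, (μ.heap aft).op = some (oid, inv) ∧ HasRet l oid b) ∧
  ∀ a, μ.Reach tailAddr a → μ.Reach a bef →
    ∀ oid inv, (μ.heap a).op = some (oid, inv) →
      ∃ l' b, (μ.heap a).lin = some l' ∧ HasRet l' oid b ∧ HasRet l oid b

/-- The result `b` of `getRetValue(oid)`: the return value of `oid` in the `lin`-field of the node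
of `oid` in the linked list. -/
def GetRetValue {S : Sig} {n : ℕ} (μ : UMem S n) (oid : ℕ) (b : S.Ret) : Prop :=
  ∃ a inv l, μ.Reach tailAddr a ∧ (μ.heap a).op = some (oid, inv) ∧
    (μ.heap a).lin = some l ∧ HasRet l oid b

/-- Control points of `apply`, each named after the statement about to be executed, with the live
local variables. In `maxHead oid k best`, the entries of `head` with index below `k` have been read
and `best` is the first of them with maximal sequence number. -/
inductive ULoc (S : Sig) (n : ℕ) where
  | genId
  | storeCall (oid : ℕ)
  | announce (oid : ℕ)
  | maxHead (oid k : ℕ) (best : Option ℕ)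
  | loop (oid : ℕ)
  | readBefore (oid : ℕ)
  | readHelp (oid bef : ℕ)
  | testHelp (oid bef help : ℕ)
  | preferHelp (oid bef help : ℕ)
  | preferOwn (oid bef : ℕ)
  | decide (oid bef prefer : ℕ)
  | readHis (oid bef aft : ℕ)
  | casHist (oid bef aft : ℕ) (h : List (Event S n))
  | genLin (oid bef aft : ℕ)
  | casLin (oid bef aft : ℕ) (l : List (TaggedOp S n))
  | setNext (oid bef aft : ℕ)
  | setSeq (oid bef aft : ℕ)
  | setHead (oid aft : ℕ)
  | finalHead (oid : ℕ)
  | getRet (oid : ℕ)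
  | storeRet (oid : ℕ) (b : S.Ret)
  | ret (b : S.Ret)

/-- The atomic steps of process `p` executing `apply(inv)`. A statement that reads several memory
locations is one step only where all but at most one of them can no longer be changed by other
processes; the entries of `head` are read one by one. -/
inductive UStep {S : Sig} {n : ℕ} (Spec : Set (List (Operation S))) (p : Fin n) (inv : S.Inv) :
    UMem S n → ULoc S n → UMem S n → ULoc S n → Prop
  /-- `oid := genID()` -/
  | genId (μ : UMem S n) :
      UStep Spec p inv μ .genId { μ with nextId := μ.nextId + 1 } (.storeCall μ.nextId)
  /-- `storeCall(m, a, pid, oid)` -/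
  | storeCall (μ : UMem S n) (oid : ℕ) :
      UStep Spec p inv μ (.storeCall oid)
        { μ with his := μ.his ++ [⟨.call p inv, oid⟩] } (.announce oid)
  /-- `announce[pid] := new Node(m, a, oid)` -/
  | announce (μ : UMem S n) (oid : ℕ) :
      UStep Spec p inv μ (.announce oid)
        { μ.set μ.nextAddr (Node.new (some (oid, inv))) with
          nextAddr := μ.nextAddr + 1
          announce := Function.update μ.announce p μ.nextAddr }
        (.maxHead oid 0 none)
  /-- one iteration of the computation of `Node.max(head)` -/
  | maxHeadStep (μ : UMem S n) (oid : ℕ) (k : Fin n) (best : Option ℕ) :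
      UStep Spec p inv μ (.maxHead oid k best) μ
        (.maxHead oid (k + 1) (some (match best with
          | none => μ.head k
          | some b => if (μ.heap b).seq < (μ.heap (μ.head k)).seq then μ.head k else b)))
  /-- `head[pid] := Node.max(head)` -/
  | maxHeadDone (μ : UMem S n) (oid b : ℕ) :
      UStep Spec p inv μ (.maxHead oid n (some b))
        { μ with head := Function.update μ.head p b } (.loop oid)
  /-- `while announce[pid].seq == 0` -/
  | loopEnter (μ : UMem S n) (oid : ℕ) :
      (μ.heap (μ.announce p)).seq = 0 →
      UStep Spec p inv μ (.loop oid) μ (.readBefore oid)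
  | loopExit (μ : UMem S n) (oid : ℕ) :
      (μ.heap (μ.announce p)).seq ≠ 0 →
      UStep Spec p inv μ (.loop oid) μ (.finalHead oid)
  /-- `before := head[pid]` -/
  | readBefore (μ : UMem S n) (oid : ℕ) :
      UStep Spec p inv μ (.readBefore oid) μ (.readHelp oid (μ.head p))
  /-- `help := announce[(before.seq + 1) % n]` -/
  | readHelp (μ : UMem S n) (oid bef : ℕ) :
      UStep Spec p inv μ (.readHelp oid bef) μ
        (.testHelp oid bef
          (μ.announce ⟨((μ.heap bef).seq + 1) % n, Nat.mod_lt _ (Fin.pos p)⟩))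
  /-- `if help.seq == 0` -/
  | testHelpPos (μ : UMem S n) (oid bef help : ℕ) :
      (μ.heap help).seq = 0 →
      UStep Spec p inv μ (.testHelp oid bef help) μ (.preferHelp oid bef help)
  | testHelpNeg (μ : UMem S n) (oid bef help : ℕ) :
      (μ.heap help).seq ≠ 0 →
      UStep Spec p inv μ (.testHelp oid bef help) μ (.preferOwn oid bef)
  /-- `prefer := help` -/
  | preferHelp (μ : UMem S n) (oid bef help : ℕ) :
      UStep Spec p inv μ (.preferHelp oid bef help) μ (.decide oid bef help)
  /-- `prefer := announce[pid]` -/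
  | preferOwn (μ : UMem S n) (oid bef : ℕ) :
      UStep Spec p inv μ (.preferOwn oid bef) μ (.decide oid bef (μ.announce p))
  /-- `after := before.decideNext.decide(prefer)`: the first proposal is decided -/
  | decideFirst (μ : UMem S n) (oid bef prefer : ℕ) :
      (μ.heap bef).decideNext = none →
      UStep Spec p inv μ (.decide oid bef prefer)
        (μ.set bef { μ.heap bef with decideNext := some prefer }) (.readHis oid bef prefer)
  | decideLater (μ : UMem S n) (oid bef prefer aft : ℕ) :
      (μ.heap bef).decideNext = some aft →
      UStep Spec p inv μ (.decide oid bef prefer) μ (.readHis oid bef aft)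
  /-- `h₁ := read()` -/
  | readHis (μ : UMem S n) (oid bef aft : ℕ) :
      UStep Spec p inv μ (.readHis oid bef aft) μ (.casHist oid bef aft μ.his)
  /-- `cas(after.hist, null, h₁)` -/
  | casHistSucc (μ : UMem S n) (oid bef aft : ℕ) (h : List (Event S n)) :
      (μ.heap aft).hist = none →
      UStep Spec p inv μ (.casHist oid bef aft h)
        (μ.set aft { μ.heap aft with hist := some h }) (.genLin oid bef aft)
  | casHistFail (μ : UMem S n) (oid bef aft : ℕ) (h : List (Event S n)) :
      (μ.heap aft).hist ≠ none →
      UStep Spec p inv μ (.casHist oid bef aft h) μ (.genLin oid bef aft)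
  /-- `l := genLin()` -/
  | genLin (μ : UMem S n) (oid bef aft : ℕ) (l : List (TaggedOp S n)) :
      GenLin Spec μ bef aft l →
      UStep Spec p inv μ (.genLin oid bef aft) μ (.casLin oid bef aft l)
  /-- `cas(after.lin, null, l)` -/
  | casLinSucc (μ : UMem S n) (oid bef aft : ℕ) (l : List (TaggedOp S n)) :
      (μ.heap aft).lin = none →
      UStep Spec p inv μ (.casLin oid bef aft l)
        (μ.set aft { μ.heap aft with lin := some l }) (.setNext oid bef aft)
  | casLinFail (μ : UMem S n) (oid bef aft : ℕ) (l : List (TaggedOp S n)) :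
      (μ.heap aft).lin ≠ none →
      UStep Spec p inv μ (.casLin oid bef aft l) μ (.setNext oid bef aft)
  /-- `before.next := after` -/
  | setNext (μ : UMem S n) (oid bef aft : ℕ) :
      UStep Spec p inv μ (.setNext oid bef aft)
        (μ.set bef { μ.heap bef with next := some aft }) (.setSeq oid bef aft)
  /-- `after.seq := before.seq + 1` -/
  | setSeq (μ : UMem S n) (oid bef aft : ℕ) :
      UStep Spec p inv μ (.setSeq oid bef aft)
        (μ.set aft { μ.heap aft with seq := (μ.heap bef).seq + 1 }) (.setHead oid aft)
  /-- `head[pid] := after` -/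
  | setHead (μ : UMem S n) (oid aft : ℕ) :
      UStep Spec p inv μ (.setHead oid aft)
        { μ with head := Function.update μ.head p aft } (.loop oid)
  /-- `head[pid] := announce[pid]` -/
  | finalHead (μ : UMem S n) (oid : ℕ) :
      UStep Spec p inv μ (.finalHead oid)
        { μ with head := Function.update μ.head p (μ.announce p) } (.getRet oid)
  /-- `b := getRetValue(oid)` -/
  | getRet (μ : UMem S n) (oid : ℕ) (b : S.Ret) :
      GetRetValue μ oid b →
      UStep Spec p inv μ (.getRet oid) μ (.storeRet oid b)
  /-- `storeReturn(m, b, pid, oid)` -/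
  | storeRet (μ : UMem S n) (oid : ℕ) (b : S.Ret) :
      UStep Spec p inv μ (.storeRet oid b)
        { μ with his := μ.his ++ [⟨.ret p inv.1 b, oid⟩] } (.ret b)

/-- The value returned by `apply` at its return statement. -/
def ULoc.result {S : Sig} {n : ℕ} : ULoc S n → Option S.Ret
  | .ret b => some b
  | _ => none

/-- The universal object of the sequential specification `Spec`, for `n` processes. A call of its
only method `apply` with argument `(m, a)` is identified with the call of `m` with argument `a`. -/
def universal {S : Sig} (Spec : Set (List (Operation S))) (n : ℕ) : ConcObj S n where
  Shared := UMem S n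
  Loc := ULoc S n
  init := UMem.init S n
  entry := fun _ => .genId
  step := UStep Spec
  result := ULoc.result

/-! ### The queue specification -/

inductive QMethod where
  | enq
  | deq

/-- `enq` takes a natural number, `deq` takes no argument. -/
abbrev QArg : QMethod → Type
  | .enq => ℕ
  | .deq => Unit

inductive QRet where
  | ack
  | val (v : ℕ)
  | empty

abbrev queueSig : Sig where
  Method := QMethod
  Arg := QArg
  Ret := QRet

abbrev enqInv (v : ℕ) : queueSig.Inv := ⟨QMethod.enq, v⟩

abbrev deqInv : queueSig.Inv := ⟨QMethod.deq, ()⟩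

/-- The sequential queue; `deq` on the empty queue returns `empty`. -/
inductive QueueStep : List ℕ → Operation queueSig → List ℕ → Prop
  | enq (q : List ℕ) (v : ℕ) : QueueStep q ⟨enqInv v, .ack⟩ (q ++ [v])
  | deq (v : ℕ) (q : List ℕ) : QueueStep (v :: q) ⟨deqInv, .val v⟩ q
  | deqEmpty : QueueStep [] ⟨deqInv, .empty⟩ []

def queueLTS : LTS (Operation queueSig) where
  State := List ℕ
  step := QueueStep
  init := []

/-- The sequential specification of the queue. -/
def queueSpec : Set (List (Operation queueSig)) := queueLTS.traces

/-! ### The Herlihy-Wing queue -/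

/-- Shared memory: the array `Q`, where `none` stands for `⊥`, and the index `X` of the next
available element. -/
structure HMem where
  Q : ℕ → Option ℕ
  X : ℕ

/-- Control points of `enq` and `deq`, with the live local variables. -/
inductive HLoc where
  | e1
  | e2 (i : ℕ)
  | e3
  | d1
  | d2 (l : ℕ)
  | d3 (l j : ℕ)
  | d4 (x : ℕ)

/-- The atomic steps of the Herlihy-Wing queue. -/
inductive HStep : queueSig.Inv → HMem → HLoc → HMem → HLoc → Prop
  /-- `E1: i := getAndInc(X)` -/
  | e1 (v : ℕ) (μ : HMem) :
      HStep (enqInv v) μ .e1 { μ with X := μ.X + 1 } (.e2 μ.X)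
  /-- `E2: Q[i] := v` -/
  | e2 (v : ℕ) (μ : HMem) (i : ℕ) :
      HStep (enqInv v) μ (.e2 i) { μ with Q := Function.update μ.Q i (some v) } .e3
  /-- `D1: l := X` -/
  | d1 (μ : HMem) :
      HStep deqInv μ .d1 μ (.d2 μ.X)
  /-- `D2: if l = 1 then go to D1, else j := 1` -/
  | d2Empty (μ : HMem) :
      HStep deqInv μ (.d2 1) μ .d1
  | d2 (μ : HMem) (l : ℕ) :
      l ≠ 1 →
      HStep deqInv μ (.d2 l) μ (.d3 l 1)
  /-- `D3: x := swap(Q[j], ⊥)`; if `x ≠ ⊥` then go to D4, -/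
  | d3Found (μ : HMem) (l j x : ℕ) :
      μ.Q j = some x →
      HStep deqInv μ (.d3 l j) { μ with Q := Function.update μ.Q j none } (.d4 x)
  /-- otherwise, if `j = l - 1` then go to D1, -/
  | d3Last (μ : HMem) (l j : ℕ) :
      μ.Q j = none → j + 1 = l →
      HStep deqInv μ (.d3 l j) { μ with Q := Function.update μ.Q j none } .d1
  /-- else `j := j + 1` and go to D3 -/
  | d3Next (μ : HMem) (l j : ℕ) :
      μ.Q j = none → j + 1 ≠ l →
      HStep deqInv μ (.d3 l j) { μ with Q := Function.update μ.Q j none } (.d3 l (j + 1))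

/-- `enq` returns `ack` at `E3`, and `deq` returns `x` at `D4`. -/
def HLoc.result : HLoc → Option QRet
  | .e3 => some .ack
  | .d4 x => some (.val x)
  | _ => none

def HLoc.entry : QMethod → HLoc
  | .enq => .e1
  | .deq => .d1

/-- The Herlihy-Wing queue, for `n` processes. -/
def herlihyWing (n : ℕ) : ConcObj queueSig n where
  Shared := HMem
  Loc := HLoc
  init := ⟨fun _ => none, 1⟩
  entry := fun inv => HLoc.entry inv.1
  step := fun _ => HStep
  result := HLoc.result

end HWSim

namespace HWSim

/-! ### Paths and histories -/

/-! The universal object follows the queue lazily. At a call it draws an identity, records the call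
and pauses just before the announcement. Internal steps of the queue are matched by the empty path.
At a return the process runs `apply` solo, from the announcement to the return. Hence between
visible actions the list carries only completed operations, and every announced node is already in
the list. The solo run therefore appends its own node after the last one, in one round of the loop,
whichever process it is supposed to help (`steps_loop`, `UnivOK.exists_ret`).

The only choice in the solo run is a linearization of the current history. `GenLin` asks that it
agree with the earlier choices on the return values of the listed operations, not on their order. So
the linearization can be built afresh from the whole run at each return, and it does no harm that
the order of concurrent enqueues is settled only by later dequeues. What remains is linearizability
with the right responses (`exists_linearization`).

For this, a run is instrumented with the slot of each enqueue and the time of each successful swap.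
Dequeues are ordered by swap time. Enqueues are ordered by the removal of their values, followed by
those not yet dequeued in the order of their calls. The two sequences are merged, an enqueue going
first when its call precedes the swap. The result is a queue run because the dequeued enqueues form
a prefix in matching order and each was called before its removal (`exists_path_merge`). It respects
real time among the dequeues and across the two kinds by comparing times (`pairwise_linOrder`).

Real time among the enqueues is the FIFO core. Suppose a dequeue with bound `l` finds the value of
`e` in slot `j`, and an enqueue `a` returned before `e` was called. Then `a` has a smaller slot,
already visited by the scan, and had been written by then; so it was found empty, and `a` had been
dequeued. This is the invariant `Scanned`, and it yields the fields `order` and `closed` of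
`QueueOK`. -/

theorem LTS.Path.append {Lab : Type} {A : LTS Lab} {c c' c'' : A.State} {ls ls' : List Lab}
    (h : A.Path c ls c') (h' : A.Path c' ls' c'') : A.Path c (ls ++ ls') c'' := by
  induction h with
  | nil => exact h'
  | cons hs _ ih => exact .cons hs (ih h')

theorem toHistory_append {S : Sig} {n : ℕ} (l l' : List (TaggedOp S n)) :
    toHistory (l ++ l') = toHistory l ++ toHistory l' := by
  simp [toHistory]

theorem procHistory_append {S : Sig} {n : ℕ} (h h' : List (Event S n)) (p : Fin n) :
    procHistory (h ++ h') p = procHistory h p ++ procHistory h' p := by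
  simp [procHistory]

theorem TaggedOp.pid_callEvent {S : Sig} {n : ℕ} (x : TaggedOp S n) :
    x.callEvent.act.pid = x.pid := rfl

theorem TaggedOp.pid_retEvent {S : Sig} {n : ℕ} (x : TaggedOp S n) :
    x.retEvent.act.pid = x.pid := rfl

theorem procHistory_toHistory {S : Sig} {n : ℕ} (l : List (TaggedOp S n)) (p : Fin n) :
    procHistory (toHistory l) p = toHistory (l.filter fun x => decide (x.pid = p)) := by
  induction l with
  | nil => rfl
  | cons x l ih =>
    simp only [procHistory, toHistory] at ih
    by_cases hx : x.pid = p
    · simp [procHistory, toHistory, TaggedOp.pid_callEvent, TaggedOp.pid_retEvent, hx, ih]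
    · simp [procHistory, toHistory, TaggedOp.pid_callEvent, TaggedOp.pid_retEvent, hx, ih]

theorem procHistory_flatMap {S : Sig} {n : ℕ} {f : Fin n → List (Event S n)}
    (hf : ∀ p, ∀ e ∈ f p, e.act.pid = p) (p : Fin n) :
    ∀ ps : List (Fin n), ps.Nodup →
      procHistory (ps.flatMap f) p = if p ∈ ps then f p else []
  | [], _ => rfl
  | q :: ps, hq => by
    have ih := procHistory_flatMap hf p ps (List.nodup_cons.1 hq).2
    rw [List.flatMap_cons, procHistory_append, ih]
    by_cases hqp : q = p
    · subst hqp
      have : procHistory (f q) q = f q := by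
        apply List.filter_eq_self.2
        intro e he
        simpa using hf q e he
      simp [this, (List.nodup_cons.1 hq).1]
    · have : procHistory (f q) p = [] := by
        apply List.filter_eq_nil_iff.2
        intro e he
        simpa [hf q e he] using hqp
      have hpq : p ≠ q := fun h => hqp h.symm
      simp [this, hpq]

theorem matched_iff_procHistory {S : Sig} {n : ℕ} (h : List (Event S n)) (e : Event S n) :
    Matched h e ↔ Matched (procHistory h e.act.pid) e := by
  constructor
  · rintro ⟨x, hx, hs⟩
    refine ⟨x, hx, ?_⟩
    have hp : e.act.pid = x.pid := by rcases hx with rfl | rfl <;> rfl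
    have := hs.filter fun e => decide (e.act.pid = x.pid)
    rw [hp]
    simpa [procHistory, List.filter_cons, TaggedOp.pid_callEvent, TaggedOp.pid_retEvent] using this
  · rintro ⟨x, hx, hs⟩
    exact ⟨x, hx, hs.trans List.filter_sublist⟩

/-- The call and the return of an operation belong to the same process, so matching never looks
outside a process subhistory. Equivalence of a completed history to a sequential one can thus be
checked process by process. -/
theorem procHistory_complete {S : Sig} {n : ℕ} (h : List (Event S n)) (p : Fin n) :
    procHistory (complete h) p = complete (procHistory h p) := by
  classical
  simp only [procHistory, complete, List.filter_filter]
  apply List.filter_congr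
  intro e _
  by_cases hp : e.act.pid = p
  · subst hp
    have := matched_iff_procHistory h e
    simp only [procHistory] at this
    simp [← this]
  · simp [hp]

theorem sublist_toHistory {S : Sig} {n : ℕ} {l : List (TaggedOp S n)} {x : TaggedOp S n}
    (hx : x ∈ l) : List.Sublist [x.callEvent, x.retEvent] (toHistory l) := by
  obtain ⟨s, t, rfl⟩ := List.append_of_mem hx
  rw [toHistory_append, show toHistory (x :: t) = [x.callEvent, x.retEvent] ++ toHistory t from rfl]
  exact (List.sublist_append_left _ _).trans (List.sublist_append_right _ _)

theorem mem_toHistory {S : Sig} {n : ℕ} {l : List (TaggedOp S n)} {e : Event S n} :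
    e ∈ toHistory l ↔ ∃ x ∈ l, e = x.callEvent ∨ e = x.retEvent := by
  simp [toHistory]

/-- A process history consisting of completed operations and pending calls with other identities
is completed by dropping the pending calls. -/
theorem complete_toHistory_append {S : Sig} {n : ℕ} (l : List (TaggedOp S n))
    (pend : List (Event S n)) (hcall : ∀ e ∈ pend, ∃ p inv, e.act = .call p inv)
    (hoid : ∀ e ∈ pend, ∀ x ∈ l, x.oid ≠ e.oid) :
    complete (toHistory l ++ pend) = toHistory l := by
  classical
  have h1 : ∀ e ∈ toHistory l, Matched (toHistory l ++ pend) e := by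
    intro e he
    obtain ⟨x, hx, hex⟩ := mem_toHistory.1 he
    exact ⟨x, hex, (sublist_toHistory hx).trans (List.sublist_append_left _ _)⟩
  have h2 : ∀ e ∈ pend, ¬ Matched (toHistory l ++ pend) e := by
    rintro e he ⟨x, hx, hs⟩
    have hmem : x.retEvent ∈ toHistory l ++ pend := hs.subset (by simp)
    have hxo : x.oid = e.oid := by rcases hx with rfl | rfl <;> rfl
    rcases List.mem_append.1 hmem with h | h
    · obtain ⟨y, hy, hxy⟩ := mem_toHistory.1 h
      have : x.oid = y.oid := by
        rcases hxy with h' | h'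
        · exact congrArg Event.oid h'
        · exact congrArg Event.oid h'
      exact hoid e he y hy (this.symm.trans hxo)
    · obtain ⟨p, inv, hp⟩ := hcall _ h
      simp [TaggedOp.retEvent] at hp
  unfold complete
  rw [List.filter_append, List.filter_eq_self.2 (fun e he => by simpa using h1 e he),
    List.filter_eq_nil_iff.2 (fun e he => by simpa using h2 e he), List.append_nil]

theorem happensBefore_toHistory {S : Sig} {n : ℕ} {l : List (TaggedOp S n)} {x y : TaggedOp S n}
    (h : List.Sublist [x, y] l) : HappensBefore (toHistory l) x.oid y.oid := by
  refine ⟨x.pid, x.op.inv.1, x.op.ret, y.pid, y.op.inv, ?_⟩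
  have h1 : List.Sublist (toHistory [x, y]) (toHistory l) := h.flatMap _
  refine List.Sublist.trans ?_ h1
  change List.Sublist [x.retEvent, y.callEvent]
    [x.callEvent, x.retEvent, y.callEvent, y.retEvent]
  exact .cons _ (.cons_cons _ (.cons_cons _ (.cons _ .slnil)))

/-- When an event is appended to a history, a new happen-before pair must end in that event. -/
theorem sublist_pair_append_singleton {α : Type*} {a b x : α} {l : List α}
    (h : List.Sublist [a, b] (l ++ [x])) : List.Sublist [a, b] l ∨ (a ∈ l ∧ b = x) := by
  rcases List.sublist_append_iff.1 h with ⟨l₁, l₂, h12, h1, h2⟩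
  rcases List.sublist_singleton.1 h2 with rfl | rfl
  · left; simpa [h12] using h1
  · right
    obtain ⟨rfl, rfl⟩ : l₁ = [a] ∧ x = b := by
      rcases l₁ with _ | ⟨c, _ | ⟨d, t⟩⟩ <;> simp_all
    exact ⟨h1.subset (by simp), rfl⟩

theorem sublist_pair_or {α : Type*} {l : List α} {x y : α} (hx : x ∈ l) (hy : y ∈ l)
    (hne : x ≠ y) : List.Sublist [x, y] l ∨ List.Sublist [y, x] l := by
  obtain ⟨s, t, rfl⟩ := List.append_of_mem hx
  rcases List.mem_append.1 hy with h | h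
  · right
    exact (List.singleton_sublist.2 h).append (List.singleton_sublist.2 List.mem_cons_self)
  · left
    rcases List.mem_cons.1 h with h | h
    · exact absurd h.symm hne
    · exact ((List.singleton_sublist.2 h).cons_cons x).trans (List.sublist_append_right _ _)

/-! ### Merging the enqueues and the dequeues -/

/-- At each step of the merge the chosen head must be related to everything left. Its own list is
covered by hypothesis. If the head `x` of `xs` is chosen, `hS` extends the comparison with the head
of `ys` to all of `ys`. If the head `y` of `ys` is chosen, it is related to `x`, and through `x` to
the rest of `xs`. -/
theorem pairwise_merge {α : Type*} {le : α → α → Bool} {R S : α → α → Prop}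
    (hS : ∀ x y y', le x y → S y y' → le x y') :
    ∀ xs ys : List α, xs.Pairwise R → ys.Pairwise R → ys.Pairwise S →
      (∀ x ∈ xs, ∀ y ∈ ys, le x y → R x y) →
      (∀ x ∈ xs, ∀ y ∈ ys, le x y = false → R y x ∧ ∀ x' ∈ xs, R x x' → R y x') →
      (xs.merge ys le).Pairwise R
  | [], ys, _, hy, _, _, _ => by simpa using hy
  | x :: xs, [], hx, _, _, _, _ => by simpa using hx
  | x :: xs, y :: ys, hx, hy, hs, h1, h2 => by
    rw [List.cons_merge_cons]
    split_ifs with h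
    · refine List.pairwise_cons.2 ⟨?_, pairwise_merge hS xs (y :: ys) (List.pairwise_cons.1 hx).2
        hy hs (fun a ha => h1 a (by simp [ha]))
        (fun a ha b hb hab => ⟨(h2 a (by simp [ha]) b hb hab).1, fun x' hx' =>
          (h2 a (by simp [ha]) b hb hab).2 x' (by simp [hx'])⟩)⟩
      intro a ha
      rcases List.mem_merge.1 ha with ha | ha
      · exact (List.pairwise_cons.1 hx).1 a ha
      · refine h1 x (by simp) a ha ?_
        rcases List.mem_cons.1 ha with rfl | ha
        · exact h
        · exact hS _ _ _ h ((List.pairwise_cons.1 hs).1 a ha)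
    · have h' : le x y = false := by simpa using h
      refine List.pairwise_cons.2 ⟨?_, pairwise_merge hS (x :: xs) ys hx
        (List.pairwise_cons.1 hy).2 (List.pairwise_cons.1 hs).2
        (fun a ha b hb => h1 a ha b (by simp [hb]))
        (fun a ha b hb => h2 a ha b (by simp [hb]))⟩
      intro a ha
      rcases List.mem_merge.1 ha with ha | ha
      · obtain ⟨h3, h4⟩ := h2 x (by simp) y (by simp) h'
        rcases List.mem_cons.1 ha with rfl | ha'
        · exact h3
        · exact h4 a ha ((List.pairwise_cons.1 hx).1 a ha')
      · exact (List.pairwise_cons.1 hy).1 a ha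
  termination_by xs ys => xs.length + ys.length

/-- A merge of a sequence of enqueues and a sequence of dequeues is a run of the queue if the
dequeues return the enqueued values in order and each dequeue comes after its enqueue. -/
theorem exists_path_merge {α : Type*} {le : α → α → Bool} {op : α → Operation queueSig}
    {val : α → ℕ} :
    ∀ (es ds : List α) (q : List ℕ),
      (∀ e ∈ es, op e = ⟨enqInv (val e), .ack⟩) →
      (∀ d ∈ ds, op d = ⟨deqInv, .val (val d)⟩) →
      ds.map val <+: q ++ es.map val →
      (∀ i e d, es[i]? = some e → ds[i + q.length]? = some d → le e d) →
      ∃ q', queueLTS.Path q ((es.merge ds le).map op) q'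
  | [], [], q, _, _, _, _ => ⟨q, by simpa using LTS.Path.nil (A := queueLTS) q⟩
  | [], d :: ds, q, he, hd, hp, hm => by
    rcases q with _ | ⟨v, q⟩
    · simp at hp
    obtain ⟨hv, hp'⟩ : val d = v ∧ ds.map val <+: q := by simpa using hp
    obtain ⟨q', hq'⟩ := exists_path_merge (le := le) [] ds q he
      (fun a ha => hd a (by simp [ha])) (by simpa using hp') (by simp)
    refine ⟨q', ?_⟩
    simp only [List.nil_merge, List.map_cons] at hq' ⊢
    refine .cons ?_ hq'
    rw [hd d (by simp), hv]
    exact QueueStep.deq v q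
  | e :: es, [], q, he, hd, hp, hm => by
    obtain ⟨q', hq'⟩ := exists_path_merge (le := le) es [] (q ++ [val e])
      (fun a ha => he a (by simp [ha])) hd (by simp) (by simp)
    refine ⟨q', ?_⟩
    simp only [List.merge_right, List.map_cons] at hq' ⊢
    refine .cons ?_ hq'
    rw [he e (by simp)]
    exact QueueStep.enq q _
  | e :: es, d :: ds, q, he, hd, hp, hm => by
    rw [List.cons_merge_cons]
    split_ifs with h
    -- The head enqueue moves into the queue content: its index drops by one while the length grows
    -- by one, so the pairing `i + q.length` is kept.
    · obtain ⟨q', hq'⟩ := exists_path_merge (le := le) es (d :: ds) (q ++ [val e])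
        (fun a ha => he a (by simp [ha])) hd (by simpa using hp)
        (fun i a b ha hb => hm (i + 1) a b (by simpa using ha)
          (by rw [← hb]; congr 1; simp; omega))
      refine ⟨q', ?_⟩
      rw [List.map_cons]
      refine .cons ?_ hq'
      rw [he e (by simp)]
      exact QueueStep.enq q _
    -- On empty content the head dequeue is the partner of the head enqueue, and the merge would
    -- have put the enqueue first.
    · rcases q with _ | ⟨v, q⟩
      · exact absurd (hm 0 e d (by simp) (by simp)) h
      obtain ⟨hv, hp'⟩ : val d = v ∧ ds.map val <+: q ++ (e :: es).map val := by simpa using hp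
      obtain ⟨q', hq'⟩ := exists_path_merge (le := le) (e :: es) ds q he
        (fun a ha => hd a (by simp [ha])) hp'
        (fun i a b ha hb => hm i a b ha (by rw [← hb]; simp [← add_assoc]))
      refine ⟨q', ?_⟩
      rw [List.map_cons]
      refine .cons ?_ hq'
      rw [hd d (by simp), hv]
      exact QueueStep.deq v q
  termination_by es ds => es.length + ds.length

/-! ### Instrumented runs of the Herlihy-Wing queue -/

/-- Auxiliary data of a run of the Herlihy-Wing queue. Operations are identified by their number in
the order of the calls. Points in time are positions in the history `hist`; `idx` and `written`
describe the array slot of an enqueue, and `swaps` lists the pairs of a dequeue that has removed a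
value and the enqueue of this value, in the order of the removals. -/
structure Run (n : ℕ) where
  hist : List (Event queueSig n)
  size : ℕ
  pid : ℕ → Fin n
  inv : ℕ → queueSig.Inv
  res : ℕ → QRet
  callTime : ℕ → ℕ
  retTime : ℕ → Option ℕ
  cur : Fin n → Option ℕ
  done : Fin n → List ℕ
  idx : ℕ → Option ℕ
  written : ℕ → Prop
  swaps : List (ℕ × ℕ)
  swapTime : ℕ → ℕ

namespace Run

variable {n : ℕ}

/-- The number of an operation doubles as its identity, which `UnivOK.nextId` keeps in step with the
identities drawn by the universal object. The response is a placeholder until the operation is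
resolved. -/
def op (G : Run n) (k : ℕ) : TaggedOp queueSig n := ⟨G.pid k, k, ⟨G.inv k, G.res k⟩⟩

/-- Operation `a` has returned before operation `b` was called. -/
def Before (G : Run n) (a b : ℕ) : Prop :=
  a < G.size ∧ b < G.size ∧ ∃ r, G.retTime a = some r ∧ r < G.callTime b

def Dequeued (G : Run n) (e : ℕ) : Prop := e ∈ G.swaps.map Prod.snd

def Swapped (G : Run n) (d : ℕ) : Prop := d ∈ G.swaps.map Prod.fst

/-- Consistency of the history with the data about calls and returns. -/
structure HistOK (G : Run n) : Prop where
  proc_hist : ∀ p, procHistory G.hist p =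
    toHistory ((G.done p).map G.op) ++ (G.cur p).toList.map fun k => (G.op k).callEvent
  hb : ∀ a b, HappensBefore G.hist a b → G.Before a b
  ret_mem : ∀ p m b o, (⟨.ret p m b, o⟩ : Event queueSig n) ∈ G.hist →
    o < G.size ∧ ∃ r, G.retTime o = some r
  call_lt : ∀ k < G.size, G.callTime k < G.hist.length
  ret_lt : ∀ k < G.size, ∀ r, G.retTime k = some r → G.callTime k < r ∧ r < G.hist.length
  cur_spec : ∀ p k, G.cur p = some k ↔ k < G.size ∧ G.pid k = p ∧ G.retTime k = none
  done_spec : ∀ p k, k ∈ G.done p ↔ k < G.size ∧ G.pid k = p ∧ G.retTime k ≠ none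
  done_sorted : ∀ p, (G.done p).Pairwise (· < ·)
  call_mono : ∀ a b, a < b → b < G.size → G.callTime a < G.callTime b
  seq : ∀ a b, a < b → b < G.size → G.pid a = G.pid b → G.Before a b

/-- Every enqueue in a slot below `j` that precedes an enqueue in a slot below `l` has been
dequeued. -/
def Scanned (G : Run n) (l j : ℕ) : Prop :=
  ∀ e e' i i', G.idx e = some i → i < j → G.idx e' = some i' → i' < l → G.Before e e' →
    G.Dequeued e

/-- Operation `k` is at the control point given by the last argument. -/
def LocOK (G : Run n) (X k : ℕ) : HLoc → Prop
  | .e1 => (∃ v, G.inv k = enqInv v) ∧ G.idx k = none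
  | .e2 i => (∃ v, G.inv k = enqInv v) ∧ G.idx k = some i ∧ ¬ G.written k
  | .e3 => (∃ v, G.inv k = enqInv v) ∧ G.written k
  | .d1 => G.inv k = deqInv ∧ ¬ G.Swapped k
  | .d2 l => G.inv k = deqInv ∧ ¬ G.Swapped k ∧ 1 ≤ l ∧ l ≤ X
  | .d3 l j => G.inv k = deqInv ∧ ¬ G.Swapped k ∧ 1 ≤ j ∧ j < l ∧ l ≤ X ∧ G.Scanned l j
  | .d4 x => G.inv k = deqInv ∧ G.Swapped k ∧ G.res k = .val x

/-- The fields up to `slot` tie the configuration to the run: a slot is full exactly when its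
enqueue has written and has not been dequeued. The fields on swaps place each swap between the call
and the return of its dequeue, and after the call of its enqueue. The last three carry the FIFO
property: slots follow real time, removals do not contradict it, and the dequeued enqueues are
closed under real-time predecessors. -/
structure QueueOK (G : Run n) (c : (herlihyWing n).Config) : Prop where
  X_pos : 1 ≤ c.mem.X
  proc_none : ∀ p, c.proc p = none → G.cur p = none
  proc_some : ∀ p i ℓ, c.proc p = some (i, ℓ) →
    ∃ k, G.cur p = some k ∧ G.inv k = i ∧ G.LocOK c.mem.X k ℓ
  idx_spec : ∀ e i, G.idx e = some i →
    e < G.size ∧ 1 ≤ i ∧ i < c.mem.X ∧ ∃ v, G.inv e = enqInv v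
  idx_inj : ∀ a b i, G.idx a = some i → G.idx b = some i → a = b
  written_idx : ∀ e, G.written e → ∃ i, G.idx e = some i
  ret_written : ∀ k < G.size, G.retTime k ≠ none → ∀ v, G.inv k = enqInv v → G.written k
  ret_swapped : ∀ k < G.size, G.retTime k ≠ none → G.inv k = deqInv → G.Swapped k
  enq_res : ∀ k < G.size, ∀ v, G.inv k = enqInv v → G.res k = .ack
  full : ∀ i v, c.mem.Q i = some v →
    ∃ e, G.idx e = some i ∧ G.written e ∧ ¬ G.Dequeued e ∧ G.inv e = enqInv v
  slot : ∀ e i, G.idx e = some i → G.written e → ¬ G.Dequeued e → c.mem.Q i ≠ none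
  swap_spec : ∀ d e, (d, e) ∈ G.swaps → d < G.size ∧ G.inv d = deqInv ∧ G.written e ∧
    (∃ v, G.inv e = enqInv v ∧ G.res d = .val v) ∧ G.callTime e < G.swapTime d ∧
    G.callTime d < G.swapTime d ∧ G.swapTime d ≤ G.hist.length ∧
    ∀ r, G.retTime d = some r → G.swapTime d ≤ r
  swapped_nodup : (G.swaps.map Prod.fst).Nodup
  dequeued_nodup : (G.swaps.map Prod.snd).Nodup
  swaps_sorted : (G.swaps.map Prod.fst).Pairwise fun x y => G.swapTime x ≤ G.swapTime y
  idx_mono : ∀ a b i j, G.Before a b → G.idx a = some i → G.idx b = some j → i < j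
  order : (G.swaps.map Prod.snd).Pairwise fun x y => ¬ G.Before y x
  closed : ∀ a e, G.Dequeued e → G.Before a e → (∃ v, G.inv a = enqInv v) → G.Dequeued a

/-- The value written or removed by an operation. -/
def val (G : Run n) (k : ℕ) : ℕ :=
  match G.inv k with
  | ⟨.enq, v⟩ => v
  | ⟨.deq, _⟩ => match G.res k with
    | .val v => v
    | _ => 0

/-- The response of the operation is determined. -/
def Resolved (G : Run n) (k : ℕ) : Prop := (∃ v, G.inv k = enqInv v) ∨ G.Swapped k

theorem inv_cases (G : Run n) (k : ℕ) : (∃ v, G.inv k = enqInv v) ∨ G.inv k = deqInv := by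
  rcases G.inv k with ⟨_ | _, v⟩
  · exact .inl ⟨v, rfl⟩
  · exact .inr rfl

theorem Before.ne_of_histOK {G : Run n} (hG : G.HistOK) {a b : ℕ} (h : G.Before a b) : a ≠ b := by
  rintro rfl
  obtain ⟨h1, -, r, hr, hlt⟩ := h
  have := (hG.ret_lt a h1 r hr).1
  omega

theorem Before.lt_of_histOK {G : Run n} (hG : G.HistOK) {a b : ℕ} (h : G.Before a b) : a < b := by
  have hne := h.ne_of_histOK hG
  obtain ⟨h1, h2, r, hr, hlt⟩ := h
  have := (hG.ret_lt a h1 r hr).1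
  by_contra hab
  have := hG.call_mono b a (by omega) h1
  omega

/-! ### The linearization of a run -/

open Classical in
/-- The enqueues, the dequeued ones first. -/
noncomputable def enqs (G : Run n) : List ℕ :=
  G.swaps.map Prod.snd ++
    (List.range G.size).filter fun k => decide ((∃ v, G.inv k = enqInv v) ∧ ¬ G.Dequeued k)

/-- Every pending enqueue is included, even one without a slot, whereas a dequeue enters only after
its swap. Since times are history positions, the comparison says that the call of `e` had occurred
when `d` made its swap. -/
noncomputable def linOrder (G : Run n) : List ℕ :=
  G.enqs.merge (G.swaps.map Prod.fst) fun e d => decide (G.callTime e < G.swapTime d)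

section

variable {G : Run n} {c : (herlihyWing n).Config}

theorem QueueOK.swapped_spec (hQ : G.QueueOK c) {d : ℕ} (h : G.Swapped d) :
    d < G.size ∧ G.inv d = deqInv ∧ (∃ v, G.res d = .val v) ∧ G.callTime d < G.swapTime d ∧
      G.swapTime d ≤ G.hist.length ∧ ∀ r, G.retTime d = some r → G.swapTime d ≤ r := by
  obtain ⟨⟨d, e⟩, hde, rfl⟩ := List.mem_map.1 h
  obtain ⟨h1, h2, -, ⟨v, -, h3⟩, -, h4⟩ := hQ.swap_spec d e hde
  exact ⟨h1, h2, ⟨v, h3⟩, h4⟩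

theorem QueueOK.dequeued_spec (hQ : G.QueueOK c) {e : ℕ} (h : G.Dequeued e) :
    e < G.size ∧ (∃ v, G.inv e = enqInv v) ∧ G.written e := by
  obtain ⟨⟨d, e⟩, hde, rfl⟩ := List.mem_map.1 h
  obtain ⟨h1, h2, h3, ⟨v, h4, -⟩, -⟩ := hQ.swap_spec d e hde
  obtain ⟨i, hi⟩ := hQ.written_idx _ h3
  exact ⟨(hQ.idx_spec _ _ hi).1, ⟨v, h4⟩, h3⟩

theorem QueueOK.mem_enqs (hQ : G.QueueOK c) {k : ℕ} :
    k ∈ G.enqs ↔ k < G.size ∧ ∃ v, G.inv k = enqInv v := by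
  classical
  simp only [enqs, List.mem_append, List.mem_filter, List.mem_range, decide_eq_true_eq]
  constructor
  · rintro (h | h)
    · exact ⟨(hQ.dequeued_spec h).1, (hQ.dequeued_spec h).2.1⟩
    · exact ⟨h.1, h.2.1⟩
  · rintro ⟨h1, h2⟩
    by_cases h : G.Dequeued k
    · exact .inl h
    · exact .inr ⟨h1, h2, h⟩

theorem QueueOK.nodup_enqs (hQ : G.QueueOK c) : G.enqs.Nodup := by
  classical
  refine List.nodup_append.2 ⟨hQ.dequeued_nodup, List.nodup_range.filter _, ?_⟩
  rintro a ha b hb rfl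
  simp only [List.mem_filter, decide_eq_true_eq] at hb
  exact hb.2.2 ha

/-- Dequeued enqueues are in order by `order`, and the others by the order of their calls. An
enqueue not yet dequeued cannot precede a dequeued one, by `closed`. -/
theorem QueueOK.pairwise_enqs (hG : G.HistOK) (hQ : G.QueueOK c) :
    G.enqs.Pairwise fun x y => ¬ G.Before y x := by
  classical
  refine List.pairwise_append.2 ⟨hQ.order, ?_, ?_⟩
  · refine List.Pairwise.filter _ (List.pairwise_lt_range.imp ?_)
    intro a b hab h
    exact absurd (h.lt_of_histOK hG) (by omega)
  · intro a ha b hb h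
    simp only [List.mem_filter, decide_eq_true_eq] at hb
    exact hb.2.2 (hQ.closed b a ha h hb.2.1)

theorem QueueOK.mem_linOrder (hQ : G.QueueOK c) {k : ℕ} :
    k ∈ G.linOrder ↔ k < G.size ∧ G.Resolved k := by
  rw [linOrder, List.mem_merge, hQ.mem_enqs, Resolved, and_or_left]
  exact or_congr Iff.rfl ⟨fun h => ⟨(hQ.swapped_spec h).1, h⟩, fun h => h.2⟩

theorem QueueOK.nodup_linOrder (hQ : G.QueueOK c) : G.linOrder.Nodup := by
  refine (List.merge_perm_append (le := _)).nodup_iff.2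
    (List.nodup_append.2 ⟨hQ.nodup_enqs, hQ.swapped_nodup, ?_⟩)
  rintro a ha b hb rfl
  obtain ⟨v, hv⟩ := (hQ.mem_enqs.1 ha).2
  have := (hQ.swapped_spec hb).2.1
  rw [hv] at this
  simp at this

theorem QueueOK.pairwise_linOrder (hG : G.HistOK) (hQ : G.QueueOK c) :
    G.linOrder.Pairwise fun x y => ¬ G.Before y x := by
  refine pairwise_merge (S := fun x y => G.swapTime x ≤ G.swapTime y) ?_ _ _
    (hQ.pairwise_enqs hG) ?_ hQ.swaps_sorted ?_ ?_
  · intro x y y' h h'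
    simp only [decide_eq_true_eq] at h ⊢
    omega
  -- Two dequeues: had the later one in the list returned before the call of the earlier one, its
  -- swap would be strictly earlier too.
  · refine List.Pairwise.imp_of_mem ?_ hQ.swaps_sorted
    rintro x y hx hy hxy ⟨-, -, r, hr, hlt⟩
    have h1 := (hQ.swapped_spec hy).2.2.2.2.2 r hr
    have h2 := (hQ.swapped_spec hx).2.2.2.1
    omega
  · rintro e he d hd hed ⟨-, -, r, hr, hlt⟩
    simp only [decide_eq_true_eq] at hed
    have := (hQ.swapped_spec hd).2.2.2.2.2 r hr
    omega
  -- Here the swap of `d` is no later than the call of `e`. If `e`, or an enqueue `e'` listed after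
  -- it, had returned before the call of `d`, it would have returned before the call of `e`; for `e`
  -- this is absurd, for `e'` it contradicts the order of the enqueues.
  · intro e he d hd hed
    simp only [decide_eq_false_iff_not] at hed
    have h1 := (hQ.swapped_spec hd).2.2.2.1
    constructor
    · rintro ⟨h2, -, r, hr, hlt⟩
      have := (hG.ret_lt e h2 r hr).1
      omega
    · rintro e' - hee' ⟨h2, -, r, hr, hlt⟩
      exact hee' ⟨h2, (hQ.mem_enqs.1 he).1, r, hr, by omega⟩

theorem QueueOK.linOrder_mem_spec (hQ : G.QueueOK c) :
    (G.linOrder.map G.op).map TaggedOp.op ∈ queueSpec := by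
  rw [List.map_map]
  refine exists_path_merge (val := G.val) _ _ [] ?_ ?_ ?_ ?_
  · intro e he
    obtain ⟨h1, v, hv⟩ := hQ.mem_enqs.1 he
    simp [op, val, hv, hQ.enq_res e h1 v hv]
  · intro d hd
    obtain ⟨-, h1, ⟨v, hv⟩, -⟩ := hQ.swapped_spec hd
    simp [op, val, h1, hv]
  · rw [List.nil_append, enqs, List.map_append]
    have : (G.swaps.map Prod.fst).map G.val = (G.swaps.map Prod.snd).map G.val := by
      rw [List.map_map, List.map_map]
      refine List.map_congr_left ?_
      rintro ⟨d, e⟩ hde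
      obtain ⟨-, h1, -, ⟨v, hv, hr⟩, -⟩ := hQ.swap_spec d e hde
      simp [val, hv, hr, h1]
    rw [this]
    exact List.prefix_append _ _
  -- The first part of `enqs` runs parallel to the dequeues, so equal positions come from one pair
  -- in `swaps`.
  · intro i e d he hd
    simp only [List.length_nil, add_zero, List.getElem?_map, Option.map_eq_some_iff] at hd
    obtain ⟨⟨d', e'⟩, hde, rfl⟩ := hd
    have hlt : i < G.swaps.length := (List.getElem?_eq_some_iff.1 hde).1
    rw [enqs, List.getElem?_append_left (by simpa using hlt), List.getElem?_map, hde] at he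
    obtain rfl : e' = e := by simpa using he
    simpa using (hQ.swap_spec _ _ (List.mem_of_getElem? hde)).2.2.2.2.1

/-- Operations of one process are totally ordered in real time, in the order of their numbers. As
`linOrder` contains no real-time inversion, its restriction to a process is increasing, hence
determined by its members. -/
theorem filter_linOrder (hG : G.HistOK) (hQ : G.QueueOK c) (p : Fin n) (l : List ℕ)
    (hl : l.Pairwise (· < ·)) (hmem : ∀ k, k ∈ l ↔ k < G.size ∧ G.pid k = p ∧ G.Resolved k) :
    (G.linOrder.filter fun k => decide (G.pid k = p)) = l := by
  have hperm : (G.linOrder.filter fun k => decide (G.pid k = p)).Perm l := by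
    refine (List.perm_ext_iff_of_nodup (hQ.nodup_linOrder.filter _)
      (hl.imp fun h => Nat.ne_of_lt h)).2 ?_
    intro k
    rw [List.mem_filter, hQ.mem_linOrder, hmem, decide_eq_true_eq]
    tauto
  refine hperm.eq_of_pairwise (le := (· < ·)) (fun a b _ _ h1 h2 => by omega) ?_ hl
  have hp := ((hQ.pairwise_linOrder hG).and hQ.nodup_linOrder).filter
    fun k => decide (G.pid k = p)
  refine hp.imp_of_mem ?_
  rintro a b ha hb ⟨h1, h2⟩
  simp only [List.mem_filter, hQ.mem_linOrder, decide_eq_true_eq] at ha hb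
  by_contra hab
  exact h1 (hG.seq b a (by omega) ha.1.1 (by rw [ha.2, hb.2]))

open Classical in
/-- The completion of the history by the responses that are determined. -/
noncomputable def pendingRets (G : Run n) : List (Event queueSig n) :=
  (List.finRange n).flatMap fun p =>
    ((G.cur p).toList.filter fun k => decide (G.Resolved k)).map fun k => (G.op k).retEvent

/-- The history is completed by returns for exactly the pending resolved operations. Each process
has at most one of these, after its completed operations, so its subhistory lists its resolved
operations in increasing order, which is what `filter_linOrder` finds in `linOrder`. -/
theorem exists_linearization (hG : G.HistOK) (hQ : G.QueueOK c) :
    ∃ l, IsLinearization queueSpec G.hist l ∧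
      ∀ k < G.size, G.Resolved k → HasRet l k (G.res k) := by
  classical
  refine ⟨G.linOrder.map G.op, ⟨hQ.linOrder_mem_spec, ⟨G.pendingRets, ?_, ?_⟩, ?_⟩, ?_⟩
  · intro e he
    simp only [pendingRets, List.mem_flatMap, List.mem_map] at he
    obtain ⟨p, -, k, -, rfl⟩ := he
    exact ⟨_, _, _, rfl⟩
  · intro p
    have hret : ∀ k < G.size, G.retTime k ≠ none → G.Resolved k := fun k h1 h2 =>
      (G.inv_cases k).imp id (hQ.ret_swapped k h1 h2)
    have hrets : procHistory G.pendingRets p =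
        ((G.cur p).toList.filter fun k => decide (G.Resolved k)).map
          fun k => (G.op k).retEvent := by
      rw [pendingRets, procHistory_flatMap _ _ _ (List.nodup_finRange n),
        if_pos (List.mem_finRange p)]
      intro q e he
      simp only [List.mem_map, List.mem_filter, Option.mem_toList] at he
      obtain ⟨k, ⟨hk, -⟩, rfl⟩ := he
      exact ((hG.cur_spec q k).1 hk).2.1
    rw [procHistory_complete, procHistory_append, hG.proc_hist, hrets, procHistory_toHistory]
    have hfilter : ∀ l : List ℕ, l.Pairwise (· < ·) →
        (∀ k, k ∈ l ↔ k < G.size ∧ G.pid k = p ∧ G.Resolved k) →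
        ((G.linOrder.map G.op).filter fun x => decide (x.pid = p)) = l.map G.op := by
      intro l hl hmem
      rw [List.filter_map, ← filter_linOrder hG hQ p l hl hmem]
      rfl
    -- Otherwise the pending operation would have had to return before the next call of the same
    -- process.
    have hdone : ∀ k ∈ G.done p, ∀ k', G.cur p = some k' → k < k' := by
      intro k hk k' hk'
      obtain ⟨h1, h2, h3⟩ := (hG.done_spec p k).1 hk
      obtain ⟨h4, h5, h6⟩ := (hG.cur_spec p k').1 hk'
      by_contra hlt
      rcases Nat.lt_or_eq_of_le (Nat.le_of_not_lt hlt) with hlt | rfl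
      · obtain ⟨-, -, r, hr, -⟩ := hG.seq k' k hlt h1 (by rw [h2, h5])
        simp [h6] at hr
      · exact h3 h6
    have hmem : ∀ k, k < G.size ∧ G.pid k = p ↔ k ∈ G.done p ∨ G.cur p = some k := by
      intro k
      rw [hG.done_spec, hG.cur_spec]
      tauto
    by_cases hres : ∃ k, G.cur p = some k ∧ G.Resolved k
    · obtain ⟨k, hk, hkr⟩ := hres
      rw [hfilter (G.done p ++ [k])]
      · rw [hk, List.map_append, toHistory_append]
        have := complete_toHistory_append ((G.done p).map G.op ++ [G.op k]) [] (by simp) (by simp)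
        rw [toHistory_append, List.append_nil] at this
        simpa [hkr, toHistory] using this
      · refine List.pairwise_append.2 ⟨hG.done_sorted p, by simp, ?_⟩
        intro a ha b hb
        rw [List.mem_singleton.1 hb]
        exact hdone a ha k hk
      · intro a
        rw [← and_assoc, hmem, List.mem_append, List.mem_singleton, hk]
        constructor
        · rintro (h | rfl)
          · exact ⟨.inl h, hret a ((hG.done_spec p a).1 h).1 ((hG.done_spec p a).1 h).2.2⟩
          · exact ⟨.inr rfl, hkr⟩
        · rintro ⟨h | h, -⟩
          · exact .inl h
          · exact .inr (Option.some.inj h).symm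
    · have hnil : ((G.cur p).toList.filter fun k => decide (G.Resolved k)) = [] := by
        refine List.filter_eq_nil_iff.2 ?_
        intro k hk
        simp only [Option.mem_toList] at hk
        simpa using fun h => hres ⟨k, hk, h⟩
      rw [hfilter (G.done p) (hG.done_sorted p), hnil, List.map_nil, List.append_nil]
      · refine complete_toHistory_append _ _ ?_ ?_
        · intro e he
          simp only [List.mem_map] at he
          obtain ⟨k, -, rfl⟩ := he
          exact ⟨_, _, rfl⟩
        · intro e he x hx
          simp only [List.mem_map, Option.mem_toList] at he hx
          obtain ⟨k, hk, rfl⟩ := he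
          obtain ⟨k', hk', rfl⟩ := hx
          exact Nat.ne_of_lt (hdone k' hk' k hk)
      · intro a
        rw [← and_assoc, hmem]
        constructor
        · exact fun h => ⟨.inl h, hret a ((hG.done_spec p a).1 h).1 ((hG.done_spec p a).1 h).2.2⟩
        · rintro ⟨h | h, h'⟩
          · exact h
          · exact absurd ⟨a, h, h'⟩ hres
  · intro x hx y hy hxy
    have hb := hG.hb _ _ hxy
    have hne : x ≠ y := fun h => hb.ne_of_histOK hG (by rw [h])
    have hp : (G.linOrder.map G.op).Pairwise fun x y => ¬ G.Before y.oid x.oid :=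
      List.pairwise_map.2 (hQ.pairwise_linOrder hG)
    rcases sublist_pair_or hx hy hne with h | h
    · exact happensBefore_toHistory h
    · exact absurd hb (by simpa using hp.sublist h)
  · intro k hk hr
    exact ⟨G.op k, List.mem_map_of_mem (hQ.mem_linOrder.2 ⟨hk, hr⟩), rfl, rfl⟩

end

/-! ### Calls and returns -/

/-- The response `ack` is final for an enqueue and a placeholder for a dequeue, to be replaced at
its swap. -/
def addCall (G : Run n) (p : Fin n) (i : queueSig.Inv) : Run n :=
  { G with
    hist := G.hist ++ [⟨.call p i, G.size⟩]
    size := G.size + 1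
    pid := Function.update G.pid G.size p
    inv := Function.update G.inv G.size i
    res := Function.update G.res G.size .ack
    callTime := Function.update G.callTime G.size G.hist.length
    retTime := Function.update G.retTime G.size none
    cur := Function.update G.cur p (some G.size) }

def addRet (G : Run n) (p : Fin n) (k : ℕ) : Run n :=
  { G with
    hist := G.hist ++ [(G.op k).retEvent]
    retTime := Function.update G.retTime k (some G.hist.length)
    cur := Function.update G.cur p none
    done := Function.update G.done p (G.done p ++ [k]) }

theorem HistOK.before_of_cur_none {G : Run n} (hG : G.HistOK) {p : Fin n} (hp : G.cur p = none)
    {k : ℕ} (hk : k < G.size) (hkp : G.pid k = p) : ∃ r, G.retTime k = some r := by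
  rcases hr : G.retTime k with _ | r
  · rw [(hG.cur_spec p k).2 ⟨hk, hkp, hr⟩] at hp
    cases hp
  · exact ⟨r, rfl⟩

theorem op_addCall {G : Run n} {p : Fin n} {i : queueSig.Inv} {k : ℕ} (hk : k < G.size) :
    (G.addCall p i).op k = G.op k := by
  simp [op, addCall, Function.update_of_ne (Nat.ne_of_lt hk)]

theorem before_addCall_of_lt {G : Run n} {p : Fin n} {i : queueSig.Inv} {a b : ℕ}
    (ha : a < G.size) (hb : b < G.size) : (G.addCall p i).Before a b ↔ G.Before a b := by
  simp only [Before, addCall, Function.update_of_ne (Nat.ne_of_lt ha),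
    Function.update_of_ne (Nat.ne_of_lt hb)]
  simp only [ha, hb, Nat.lt_succ_of_lt ha, Nat.lt_succ_of_lt hb]

theorem before_addCall_size {G : Run n} (hG : G.HistOK) {p : Fin n} {i : queueSig.Inv} {a : ℕ} :
    (G.addCall p i).Before a G.size ↔ a < G.size ∧ ∃ r, G.retTime a = some r := by
  simp only [Before, addCall, Function.update_self]
  constructor
  · rintro ⟨h1, -, r, hr, hlt⟩
    rcases Nat.lt_or_eq_of_le (Nat.le_of_lt_succ h1) with h | rfl
    · rw [Function.update_of_ne (Nat.ne_of_lt h)] at hr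
      exact ⟨h, r, hr⟩
    · simp at hr
  · rintro ⟨h, r, hr⟩
    refine ⟨Nat.lt_succ_of_lt h, Nat.lt_succ_self _, r, ?_, (hG.ret_lt a h r hr).2⟩
    rwa [Function.update_of_ne (Nat.ne_of_lt h)]

theorem not_before_addCall {G : Run n} {p : Fin n} {i : queueSig.Inv} {b : ℕ} :
    ¬ (G.addCall p i).Before G.size b := by
  rintro ⟨-, -, r, hr, -⟩
  simp [addCall] at hr

theorem before_addCall {G : Run n} {p : Fin n} {i : queueSig.Inv} {a b : ℕ}
    (hb : b < G.size) : (G.addCall p i).Before a b ↔ G.Before a b := by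
  constructor
  · intro h
    rcases Nat.lt_or_eq_of_le (Nat.le_of_lt_succ h.1) with ha | rfl
    · exact (before_addCall_of_lt ha hb).1 h
    · exact absurd h not_before_addCall
  · exact fun h => (before_addCall_of_lt h.1 hb).2 h

theorem HistOK.addCall {G : Run n} (hG : G.HistOK) {p : Fin n} (i : queueSig.Inv)
    (hp : G.cur p = none) : (G.addCall p i).HistOK where
  proc_hist q := by
    have hops : ((G.done q).map (G.addCall p i).op) = (G.done q).map G.op :=
      List.map_congr_left fun k hk => op_addCall ((hG.done_spec q k).1 hk).1
    change procHistory (G.hist ++ [_]) q = toHistory ((G.done q).map _) ++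
      ((Function.update G.cur p (some G.size) q).toList.map _)
    rw [hops, procHistory_append, hG.proc_hist]
    by_cases hq : q = p
    · subst hq
      simp [hp, procHistory, Action.pid, Run.addCall, op, TaggedOp.callEvent]
    · rw [Function.update_of_ne hq]
      have : (G.cur q).toList.map (fun k => ((G.addCall p i).op k).callEvent) =
          (G.cur q).toList.map fun k => (G.op k).callEvent := by
        refine List.map_congr_left fun k hk => ?_
        rw [op_addCall ((hG.cur_spec q k).1 (by simpa using hk)).1]
      rw [this]
      have hq' : p ≠ q := fun h => hq h.symm
      simp [procHistory, Action.pid, hq']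
  hb a b := by
    rintro ⟨p₁, m, r, p₂, j, hs⟩
    rcases sublist_pair_append_singleton hs with h | ⟨h, he⟩
    · have := hG.hb a b ⟨_, _, _, _, _, h⟩
      exact (before_addCall this.2.1).2 this
    · obtain rfl : b = G.size := congrArg Event.oid he
      exact (before_addCall_size hG).2 (hG.ret_mem _ _ _ _ h)
  ret_mem q m r o h := by
    rcases List.mem_append.1 h with h | h
    · obtain ⟨h1, h2⟩ := hG.ret_mem _ _ _ _ h
      refine ⟨Nat.lt_succ_of_lt h1, ?_⟩
      simpa [Run.addCall, Function.update_of_ne (Nat.ne_of_lt h1)] using h2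
    · simp at h
  call_lt k hk := by
    rcases Nat.lt_or_eq_of_le (Nat.le_of_lt_succ hk) with h | rfl
    · have := hG.call_lt k h
      simp [Run.addCall, Function.update_of_ne (Nat.ne_of_lt h)]
      omega
    · simp [Run.addCall]
  ret_lt k hk r hr := by
    rcases Nat.lt_or_eq_of_le (Nat.le_of_lt_succ hk) with h | rfl
    · simp only [Run.addCall, Function.update_of_ne (Nat.ne_of_lt h)] at hr
      have := hG.ret_lt k h r hr
      simp [Run.addCall, Function.update_of_ne (Nat.ne_of_lt h)]
      omega
    · simp [Run.addCall] at hr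
  cur_spec q k := by
    simp only [Run.addCall]
    by_cases hk : k = G.size
    · subst hk
      by_cases hq : q = p
      · simp [hq]
      · have := hG.cur_spec q G.size
        simp only [Function.update_of_ne hq, Function.update_self]
        constructor
        · intro h
          exact absurd (this.1 h).1 (lt_irrefl _)
        · exact fun h => absurd h.2.1.symm hq
    · simp only [Function.update_of_ne hk]
      by_cases hq : q = p
      · subst hq
        simp only [Function.update_self]
        constructor
        · exact fun h => absurd (Option.some.inj h).symm hk
        · rintro ⟨h1, h2, h3⟩
          have := (hG.cur_spec q k).2 ⟨by omega, h2, h3⟩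
          simp [hp] at this
      · rw [Function.update_of_ne hq, hG.cur_spec]
        constructor
        · exact fun h => ⟨by omega, h.2⟩
        · exact fun h => ⟨by omega, h.2⟩
  done_spec q k := by
    simp only [Run.addCall]
    rw [hG.done_spec]
    by_cases hk : k = G.size
    · subst hk
      simp
    · simp only [Function.update_of_ne hk]
      constructor
      · exact fun h => ⟨by omega, h.2⟩
      · exact fun h => ⟨by omega, h.2⟩
  done_sorted := hG.done_sorted
  call_mono a b hab hb := by
    have ha : a < G.size := Nat.lt_of_lt_of_le hab (Nat.le_of_lt_succ hb)
    rcases Nat.lt_or_eq_of_le (Nat.le_of_lt_succ hb) with h | rfl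
    · simpa [Run.addCall, Function.update_of_ne (Nat.ne_of_lt h),
        Function.update_of_ne (Nat.ne_of_lt ha)] using hG.call_mono a b hab h
    · simpa [Run.addCall, Function.update_of_ne (Nat.ne_of_lt ha)] using hG.call_lt a ha
  seq a b hab hb hpid := by
    have ha : a < G.size := Nat.lt_of_lt_of_le hab (Nat.le_of_lt_succ hb)
    rcases Nat.lt_or_eq_of_le (Nat.le_of_lt_succ hb) with h | rfl
    · simp only [Run.addCall, Function.update_of_ne (Nat.ne_of_lt h),
        Function.update_of_ne (Nat.ne_of_lt ha)] at hpid
      exact (before_addCall h).2 (hG.seq a b hab h hpid)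
    · simp only [Run.addCall, Function.update_self,
        Function.update_of_ne (Nat.ne_of_lt ha)] at hpid
      exact (before_addCall_size hG).2 ⟨ha, hG.before_of_cur_none hp ha hpid⟩

/-- The new return is the last event, so it precedes no call that has occurred. -/
theorem before_addRet {G : Run n} (hG : G.HistOK) {p : Fin n} {k : ℕ} (hk : G.cur p = some k)
    {a b : ℕ} : (G.addRet p k).Before a b ↔ G.Before a b := by
  simp only [Before, addRet]
  by_cases ha : a = k
  · subst ha
    simp only [Function.update_self, ((hG.cur_spec p a).1 hk).2.2]
    constructor
    · rintro ⟨-, h1, r, hr, hlt⟩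
      have := hG.call_lt b h1
      cases hr
      omega
    · simp
  · simp only [Function.update_of_ne ha]

theorem HistOK.addRet {G : Run n} (hG : G.HistOK) {p : Fin n} {k : ℕ}
    (hk : G.cur p = some k) : (G.addRet p k).HistOK where
  proc_hist q := by
    change procHistory (G.hist ++ [_]) q = toHistory ((Function.update G.done p _ q).map G.op) ++
      ((Function.update G.cur p none q).toList.map fun k => (G.op k).callEvent)
    rw [procHistory_append, hG.proc_hist]
    have hpid := ((hG.cur_spec p k).1 hk).2.1
    by_cases hq : q = p
    · subst hq
      rw [hk]
      simp [procHistory, TaggedOp.retEvent, Action.pid, op, hpid, toHistory]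
    · have hq' : p ≠ q := fun h => hq h.symm
      simp [Function.update_of_ne hq, procHistory, TaggedOp.retEvent, Action.pid, op, hpid, hq']
  hb a b := by
    rintro ⟨p₁, m, r, p₂, j, hs⟩
    rcases sublist_pair_append_singleton hs with h | ⟨h, he⟩
    · exact (before_addRet hG hk).2 (hG.hb a b ⟨_, _, _, _, _, h⟩)
    · simp [TaggedOp.retEvent] at he
  ret_mem q m r o h := by
    have hlt := ((hG.cur_spec p k).1 hk).1
    by_cases ho : o = k
    · subst ho
      exact ⟨hlt, by simp [Run.addRet]⟩
    rcases List.mem_append.1 h with h | h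
    · simpa [Run.addRet, Function.update_of_ne ho] using hG.ret_mem _ _ _ _ h
    · simp only [List.mem_singleton] at h
      exact absurd (congrArg Event.oid h) ho
  call_lt j hj := by
    have := hG.call_lt j hj
    simp [Run.addRet]
    omega
  ret_lt j hj r hr := by
    simp only [Run.addRet] at hr ⊢
    rw [List.length_append, List.length_singleton]
    by_cases hjk : j = k
    · subst hjk
      have := hG.call_lt j hj
      rw [Function.update_self] at hr
      cases hr
      omega
    · rw [Function.update_of_ne hjk] at hr
      have := hG.ret_lt j hj r hr
      omega
  cur_spec q j := by
    have hs := (hG.cur_spec p k).1 hk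
    simp only [Run.addRet]
    by_cases hq : q = p
    · subst hq
      simp only [Function.update_self]
      constructor
      · simp
      · rintro ⟨h1, h2, h3⟩
        by_cases hj : j = k
        · simp [hj] at h3
        · rw [Function.update_of_ne hj] at h3
          have := (hG.cur_spec q j).2 ⟨h1, h2, h3⟩
          rw [hk] at this
          exact absurd (Option.some.inj this).symm hj
    · rw [Function.update_of_ne hq]
      by_cases hj : j = k
      · subst hj
        rw [hG.cur_spec]
        have hq' : ¬ p = q := fun h => hq h.symm
        simp [hs, hq']
      · rw [Function.update_of_ne hj, hG.cur_spec]
  done_spec q j := by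
    have hs := (hG.cur_spec p k).1 hk
    simp only [Run.addRet]
    by_cases hj : j = k
    · subst hj
      by_cases hq : q = p
      · subst hq
        simp [hs]
      · rw [Function.update_of_ne hq, hG.done_spec]
        have hq' : ¬ p = q := fun h => hq h.symm
        simp [hs, hq']
    · rw [Function.update_of_ne hj, ← hG.done_spec]
      by_cases hq : q = p
      · subst hq
        simp [hj]
      · rw [Function.update_of_ne hq]
  done_sorted q := by
    simp only [Run.addRet]
    by_cases hq : q = p
    · subst hq
      rw [Function.update_self]
      refine List.pairwise_append.2 ⟨hG.done_sorted q, by simp, ?_⟩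
      intro a ha b hb
      rw [List.mem_singleton.1 hb]
      obtain ⟨h1, h2, h3⟩ := (hG.done_spec q a).1 ha
      obtain ⟨h4, h5, h6⟩ := (hG.cur_spec q k).1 hk
      by_contra hlt
      rcases Nat.lt_or_eq_of_le (Nat.le_of_not_lt hlt) with hlt | rfl
      · obtain ⟨-, -, r, hr, -⟩ := hG.seq k a hlt h1 (by rw [h2, h5])
        simp [h6] at hr
      · exact h3 h6
    · rw [Function.update_of_ne hq]
      exact hG.done_sorted q
  call_mono := hG.call_mono
  seq a b hab hb hpid := (before_addRet hG hk).2 (hG.seq a b hab hb hpid)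

theorem locOK_addCall {G : Run n} {p : Fin n} {i : queueSig.Inv} {X k : ℕ} (hk : k < G.size)
    (hidx : ∀ e i, G.idx e = some i → e < G.size) {ℓ : HLoc} (h : G.LocOK X k ℓ) :
    (G.addCall p i).LocOK X k ℓ := by
  have hinv : (G.addCall p i).inv k = G.inv k := Function.update_of_ne (Nat.ne_of_lt hk) _ _
  have hres : (G.addCall p i).res k = G.res k := Function.update_of_ne (Nat.ne_of_lt hk) _ _
  cases ℓ <;> simp only [LocOK, hinv, hres] at h ⊢
  case d3 l j =>
    refine ⟨h.1, h.2.1, h.2.2.1, h.2.2.2.1, h.2.2.2.2.1, ?_⟩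
    intro e e' a a' he ha he' ha' hb
    exact h.2.2.2.2.2 e e' a a' he ha he' ha' ((before_addCall (hidx _ _ he')).1 hb)
  all_goals exact h

theorem QueueOK.addCall {G : Run n} {c : (herlihyWing n).Config} (hG : G.HistOK)
    (hQ : G.QueueOK c) {p : Fin n} (i : queueSig.Inv) (hp : G.cur p = none) :
    (G.addCall p i).QueueOK
      ⟨c.mem, Function.update c.proc p (some (i, (herlihyWing n).entry i))⟩ where
  X_pos := hQ.X_pos
  proc_none q h := by
    by_cases hq : q = p
    · subst hq; simp at h
    · simp only [Function.update_of_ne hq] at h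
      simpa [Run.addCall, Function.update_of_ne hq] using hQ.proc_none q h
  proc_some q j ℓ h := by
    by_cases hq : q = p
    · subst hq
      simp only [Function.update_self, Option.some.injEq, Prod.mk.injEq] at h
      obtain ⟨rfl, rfl⟩ := h
      refine ⟨G.size, by simp [Run.addCall], by simp [Run.addCall], ?_⟩
      have hinv : (G.addCall q i).inv G.size = i := Function.update_self _ _ _
      have hidx : G.idx G.size = none := by
        rcases h : G.idx G.size with _ | a
        · rfl
        · exact absurd (hQ.idx_spec _ _ h).1 (lt_irrefl _)
      rcases i with ⟨_ | _, v⟩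
      · exact ⟨⟨v, hinv⟩, hidx⟩
      · exact ⟨hinv, fun h => absurd (hQ.swapped_spec h).1 (lt_irrefl _)⟩
    · simp only [Function.update_of_ne hq] at h
      obtain ⟨k, h1, h2, h3⟩ := hQ.proc_some q j ℓ h
      have hk := ((hG.cur_spec q k).1 h1).1
      exact ⟨k, by simpa [Run.addCall, Function.update_of_ne hq] using h1,
        by simpa [Run.addCall, Function.update_of_ne (Nat.ne_of_lt hk)] using h2,
        locOK_addCall hk (fun e a he => (hQ.idx_spec e a he).1) h3⟩
  idx_spec e a he := by
    obtain ⟨h1, h2, h3, h4⟩ := hQ.idx_spec e a he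
    exact ⟨Nat.lt_succ_of_lt h1, h2, h3,
      by simpa [Run.addCall, Function.update_of_ne (Nat.ne_of_lt h1)] using h4⟩
  idx_inj := hQ.idx_inj
  written_idx := hQ.written_idx
  ret_written k hk hr v hv := by
    rcases Nat.lt_or_eq_of_le (Nat.le_of_lt_succ hk) with h | rfl
    · simp only [Run.addCall, Function.update_of_ne (Nat.ne_of_lt h)] at hr hv
      exact hQ.ret_written k h hr v hv
    · simp [Run.addCall] at hr
  ret_swapped k hk hr hv := by
    rcases Nat.lt_or_eq_of_le (Nat.le_of_lt_succ hk) with h | rfl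
    · simp only [Run.addCall, Function.update_of_ne (Nat.ne_of_lt h)] at hr hv
      exact hQ.ret_swapped k h hr hv
    · simp [Run.addCall] at hr
  enq_res k hk v hv := by
    rcases Nat.lt_or_eq_of_le (Nat.le_of_lt_succ hk) with h | rfl
    · simp only [Run.addCall, Function.update_of_ne (Nat.ne_of_lt h)] at hv ⊢
      exact hQ.enq_res k h v hv
    · simp [Run.addCall]
  full a v h := by
    obtain ⟨e, h1, h2, h3, h4⟩ := hQ.full a v h
    exact ⟨e, h1, h2, h3, by
      simpa [Run.addCall, Function.update_of_ne (Nat.ne_of_lt (hQ.idx_spec e a h1).1)] using h4⟩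
  slot := hQ.slot
  swap_spec d e h := by
    have hd := (hQ.swapped_spec (List.mem_map_of_mem (f := Prod.fst) h)).1
    have he := (hQ.dequeued_spec (List.mem_map_of_mem (f := Prod.snd) h)).1
    have := hQ.swap_spec d e h
    simp only [Run.addCall, Function.update_of_ne (Nat.ne_of_lt hd),
      Function.update_of_ne (Nat.ne_of_lt he), List.length_append, List.length_singleton]
    exact ⟨by omega, this.2.1, this.2.2.1, this.2.2.2.1, this.2.2.2.2.1, this.2.2.2.2.2.1,
      by omega, this.2.2.2.2.2.2.2⟩
  swapped_nodup := hQ.swapped_nodup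
  dequeued_nodup := hQ.dequeued_nodup
  swaps_sorted := hQ.swaps_sorted
  idx_mono a b i j h ha hb :=
    hQ.idx_mono a b i j ((before_addCall (hQ.idx_spec _ _ hb).1).1 h) ha hb
  order := by
    refine List.Pairwise.imp_of_mem ?_ hQ.order
    intro x y hx hy h h'
    exact h ((before_addCall (hQ.dequeued_spec hx).1).1 h')
  closed a e he hb ha := by
    have hb' := (before_addCall (hQ.dequeued_spec he).1).1 hb
    refine hQ.closed a e he hb' ?_
    simpa [Run.addCall, Function.update_of_ne (Nat.ne_of_lt hb'.1)] using ha

theorem QueueOK.addRet {G : Run n} {c : (herlihyWing n).Config} (hG : G.HistOK)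
    (hQ : G.QueueOK c) {p : Fin n} {k : ℕ} (hk : G.cur p = some k)
    (hw : ∀ v, G.inv k = enqInv v → G.written k) (hs : G.inv k = deqInv → G.Swapped k) :
    (G.addRet p k).QueueOK ⟨c.mem, Function.update c.proc p none⟩ where
  X_pos := hQ.X_pos
  proc_none q h := by
    by_cases hq : q = p
    · subst hq; simp [Run.addRet]
    · simp only [Function.update_of_ne hq] at h
      simpa [Run.addRet, Function.update_of_ne hq] using hQ.proc_none q h
  proc_some q j ℓ h := by
    by_cases hq : q = p
    · subst hq
      simp at h
    · simp only [Function.update_of_ne hq] at h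
      obtain ⟨k', h1, h2, h3⟩ := hQ.proc_some q j ℓ h
      refine ⟨k', by simpa [Run.addRet, Function.update_of_ne hq] using h1, h2, ?_⟩
      cases ℓ
      case d3 l j =>
        refine ⟨h3.1, h3.2.1, h3.2.2.1, h3.2.2.2.1, h3.2.2.2.2.1, ?_⟩
        intro e e' a a' he ha he' ha' hb
        exact h3.2.2.2.2.2 e e' a a' he ha he' ha' ((before_addRet hG hk).1 hb)
      all_goals exact h3
  idx_spec := hQ.idx_spec
  idx_inj := hQ.idx_inj
  written_idx := hQ.written_idx
  ret_written j hj hr v hv := by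
    by_cases hjk : j = k
    · subst hjk; exact hw v hv
    · exact hQ.ret_written j hj (by simpa [Run.addRet, Function.update_of_ne hjk] using hr) v hv
  ret_swapped j hj hr hv := by
    by_cases hjk : j = k
    · subst hjk; exact hs hv
    · exact hQ.ret_swapped j hj (by simpa [Run.addRet, Function.update_of_ne hjk] using hr) hv
  enq_res := hQ.enq_res
  full := hQ.full
  slot := hQ.slot
  swap_spec d e h := by
    obtain ⟨h1, h2, h3, h4, h5, h6, h7, h8⟩ := hQ.swap_spec d e h
    refine ⟨h1, h2, h3, h4, h5, h6, ?_, ?_⟩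
    · simp only [Run.addRet, List.length_append, List.length_singleton]
      omega
    · intro r hr
      by_cases hdk : d = k
      · subst hdk
        simp only [Run.addRet, Function.update_self, Option.some.injEq] at hr
        exact hr ▸ h7
      · exact h8 r (by simpa [Run.addRet, Function.update_of_ne hdk] using hr)
  swapped_nodup := hQ.swapped_nodup
  dequeued_nodup := hQ.dequeued_nodup
  swaps_sorted := hQ.swaps_sorted
  idx_mono a b i j h ha hb := hQ.idx_mono a b i j ((before_addRet hG hk).1 h) ha hb
  order := hQ.order.imp fun h h' => h ((before_addRet hG hk).1 h')
  closed a e he hb ha := hQ.closed a e he ((before_addRet hG hk).1 hb) ha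

/-! ### Internal steps of the Herlihy-Wing queue -/

theorem HistOK.ne_of_cur {G : Run n} (hG : G.HistOK) {p q : Fin n} {k k' : ℕ} (hpq : q ≠ p)
    (h : G.cur p = some k) (h' : G.cur q = some k') : k' ≠ k := by
  rintro rfl
  exact hpq (((hG.cur_spec q k').1 h').2.1.symm.trans ((hG.cur_spec p k').1 h).2.1)

theorem QueueOK.setProc {G : Run n} {c : (herlihyWing n).Config} (hQ : G.QueueOK c) {p : Fin n}
    {k : ℕ} (hk : G.cur p = some k) {ℓ : HLoc} (hℓ : G.LocOK c.mem.X k ℓ) :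
    G.QueueOK ⟨c.mem, Function.update c.proc p (some (G.inv k, ℓ))⟩ :=
  { hQ with
    proc_none := fun q h => by
      by_cases hq : q = p
      · subst hq; simp at h
      · exact hQ.proc_none q (by simpa only [Function.update_of_ne hq] using h)
    proc_some := fun q j ℓ' h => by
      by_cases hq : q = p
      · subst hq
        simp only [Function.update_self, Option.some.injEq] at h
        obtain ⟨rfl, rfl⟩ := h
        exact ⟨k, hk, rfl, hℓ⟩
      · exact hQ.proc_some q j ℓ' (by simpa only [Function.update_of_ne hq] using h) }

def reserve (G : Run n) (k i : ℕ) : Run n :=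
  { G with idx := Function.update G.idx k (some i) }

theorem HistOK.reserve {G : Run n} (hG : G.HistOK) (k i : ℕ) : (G.reserve k i).HistOK :=
  { hG with }

/-- The new slot exceeds all earlier ones, which gives `idx_mono`. The scans in progress are
unaffected: their bounds are at most the old `X`, so the new slot lies beyond them, and the enqueue
is still pending, so it precedes nothing. -/
theorem QueueOK.reserve {G : Run n} {c : (herlihyWing n).Config} (hG : G.HistOK)
    (hQ : G.QueueOK c) {p : Fin n} {k v : ℕ} (hk : G.cur p = some k) (hv : G.inv k = enqInv v)
    (hidx : G.idx k = none) :
    (G.reserve k c.mem.X).QueueOK ⟨{ c.mem with X := c.mem.X + 1 },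
      Function.update c.proc p (some (enqInv v, .e2 c.mem.X))⟩ := by
  have hspec := (hG.cur_spec p k).1 hk
  have hnb : ∀ b, ¬ G.Before k b := by
    rintro b ⟨-, -, r, hr, -⟩
    simp [hspec.2.2] at hr
  have hw : ¬ G.written k := fun h => by
    obtain ⟨i, hi⟩ := hQ.written_idx k h
    simp [hidx] at hi
  have hcase : ∀ e i, Function.update G.idx k (some c.mem.X) e = some i →
      (e = k ∧ i = c.mem.X) ∨ (e ≠ k ∧ G.idx e = some i ∧ i < c.mem.X) := by
    intro e i h
    by_cases he : e = k
    · subst he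
      rw [Function.update_self] at h
      exact .inl ⟨rfl, (Option.some.inj h).symm⟩
    · rw [Function.update_of_ne he] at h
      exact .inr ⟨he, h, (hQ.idx_spec e i h).2.2.1⟩
  have hold : ∀ e i, G.idx e = some i → Function.update G.idx k (some c.mem.X) e = some i := by
    intro e i h
    rw [Function.update_of_ne, h]
    rintro rfl
    simp [hidx] at h
  exact
  { hQ with
    X_pos := Nat.succ_pos _
    proc_none := fun q h => by
      by_cases hq : q = p
      · subst hq; simp at h
      · exact hQ.proc_none q (by simpa only [Function.update_of_ne hq] using h)
    proc_some := fun q j ℓ' h => by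
      by_cases hq : q = p
      · subst hq
        simp only [Function.update_self, Option.some.injEq] at h
        obtain ⟨rfl, rfl⟩ := h
        exact ⟨k, hk, hv, ⟨v, hv⟩, Function.update_self _ _ _, hw⟩
      · obtain ⟨k', h1, h2, h3⟩ :=
          hQ.proc_some q j ℓ' (by simpa only [Function.update_of_ne hq] using h)
        refine ⟨k', h1, h2, ?_⟩
        have hkk := hG.ne_of_cur hq hk h1
        cases ℓ'
        case e1 => exact ⟨h3.1, by simpa [Run.reserve, Function.update_of_ne hkk] using h3.2⟩
        case e2 i =>
          exact ⟨h3.1, by simpa [Run.reserve, Function.update_of_ne hkk] using h3.2.1, h3.2.2⟩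
        case d2 l => exact ⟨h3.1, h3.2.1, h3.2.2.1, Nat.le_succ_of_le h3.2.2.2⟩
        case d3 l j =>
          obtain ⟨h4, h5, h6, h7, h8, h9⟩ := h3
          refine ⟨h4, h5, h6, h7, Nat.le_succ_of_le h8, ?_⟩
          intro e e' i i' he hi he' hi' hb
          rcases hcase e i he with ⟨rfl, -⟩ | ⟨-, he, -⟩
          · exact absurd hb (hnb _)
          rcases hcase e' i' he' with ⟨-, rfl⟩ | ⟨-, he', -⟩
          · exact absurd h8 (by simpa using hi')
          · exact h9 e e' i i' he hi he' hi' hb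
        all_goals exact h3
    idx_spec := fun e i h => by
      rcases hcase e i h with ⟨rfl, rfl⟩ | ⟨-, h', -⟩
      · exact ⟨hspec.1, hQ.X_pos, Nat.lt_succ_self _, v, hv⟩
      · obtain ⟨h1, h2, h3, h4⟩ := hQ.idx_spec e i h'
        exact ⟨h1, h2, Nat.lt_succ_of_lt h3, h4⟩
    idx_inj := fun a b i ha hb => by
      rcases hcase a i ha with ⟨rfl, rfl⟩ | ⟨-, ha, hi⟩ <;>
        rcases hcase b _ hb with ⟨rfl, h⟩ | ⟨-, hb, h⟩
      · rfl
      · omega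
      · omega
      · exact hQ.idx_inj a b i ha hb
    written_idx := fun e h => by
      obtain ⟨i, hi⟩ := hQ.written_idx e h
      exact ⟨i, hold e i hi⟩
    full := fun i x h => by
      obtain ⟨e, h1, h2⟩ := hQ.full i x h
      exact ⟨e, hold e i h1, h2⟩
    slot := fun e i h h' h'' => by
      rcases hcase e i h with ⟨rfl, -⟩ | ⟨-, h, -⟩
      · exact absurd h' hw
      · exact hQ.slot e i h h' h''
    idx_mono := fun a b i j h ha hb => by
      rcases hcase a i ha with ⟨rfl, -⟩ | ⟨-, ha, hi⟩
      · exact absurd h (hnb _)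
      rcases hcase b j hb with ⟨-, rfl⟩ | ⟨-, hb, -⟩
      · exact hi
      · exact hQ.idx_mono a b i j h ha hb }

def write (G : Run n) (k : ℕ) : Run n :=
  { G with written := fun e => e = k ∨ G.written e }

theorem HistOK.write {G : Run n} (hG : G.HistOK) (k : ℕ) : (G.write k).HistOK :=
  { hG with }

theorem QueueOK.write {G : Run n} {c : (herlihyWing n).Config} (hG : G.HistOK)
    (hQ : G.QueueOK c) {p : Fin n} {k v i : ℕ} (hk : G.cur p = some k) (hv : G.inv k = enqInv v)
    (hi : G.idx k = some i) (hw : ¬ G.written k) :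
    (G.write k).QueueOK ⟨{ c.mem with Q := Function.update c.mem.Q i (some v) },
      Function.update c.proc p (some (enqInv v, .e3))⟩ :=
  { hQ with
    proc_none := fun q h => by
      by_cases hq : q = p
      · subst hq; simp at h
      · exact hQ.proc_none q (by simpa only [Function.update_of_ne hq] using h)
    proc_some := fun q j ℓ' h => by
      by_cases hq : q = p
      · subst hq
        simp only [Function.update_self, Option.some.injEq] at h
        obtain ⟨rfl, rfl⟩ := h
        exact ⟨k, hk, hv, ⟨v, hv⟩, .inl rfl⟩
      · obtain ⟨k', h1, h2, h3⟩ :=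
          hQ.proc_some q j ℓ' (by simpa only [Function.update_of_ne hq] using h)
        refine ⟨k', h1, h2, ?_⟩
        cases ℓ'
        case e2 i => exact ⟨h3.1, h3.2.1, fun h => h.elim (hG.ne_of_cur hq hk h1) h3.2.2⟩
        case e3 => exact ⟨h3.1, .inr h3.2⟩
        all_goals exact h3
    written_idx := fun e h => h.elim (fun h => ⟨i, h ▸ hi⟩) (hQ.written_idx e)
    ret_written := fun e h h' x hx => .inr (hQ.ret_written e h h' x hx)
    full := fun j x h => by
      by_cases hj : j = i
      · subst hj
        simp only [Function.update_self, Option.some.injEq] at h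
        subst h
        exact ⟨k, hi, .inl rfl, fun h => hw (hQ.dequeued_spec h).2.2, hv⟩
      · simp only [Function.update_of_ne hj] at h
        obtain ⟨e, h1, h2, h3⟩ := hQ.full j x h
        exact ⟨e, h1, .inr h2, h3⟩
    slot := fun e j h h' h'' => by
      by_cases hj : j = i
      · subst hj; simp
      · simp only [Function.update_of_ne hj]
        rcases h' with rfl | h'
        · exact absurd (Option.some.inj (hi.symm.trans h)).symm hj
        · exact hQ.slot e j h h' h''
    swap_spec := fun d e h => by
      obtain ⟨h1, h2, h3, h4⟩ := hQ.swap_spec d e h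
      exact ⟨h1, h2, .inr h3, h4⟩ }

/-- With the current length of the history as swap time, earlier calls have strictly smaller
positions and later events have positions at least as large. This accounts for the mixture of `<`
and `≤` in `swap_spec`. -/
def swap (G : Run n) (d e v : ℕ) : Run n :=
  { G with
    res := Function.update G.res d (.val v)
    swaps := G.swaps ++ [(d, e)]
    swapTime := Function.update G.swapTime d G.hist.length }

/-- Only responses of completed operations occur in the history, so the response of the pending `d`
may still change. -/
theorem HistOK.swap {G : Run n} (hG : G.HistOK) {d : ℕ} (hd : G.retTime d = none) (e v : ℕ) :
    (G.swap d e v).HistOK :=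
  { hG with
    proc_hist := fun q => by
      have : (G.done q).map (G.swap d e v).op = (G.done q).map G.op := by
        refine List.map_congr_left fun k hk => ?_
        have hkd : k ≠ d := by
          rintro rfl
          exact ((hG.done_spec q k).1 hk).2.2 hd
        simp [op, Run.swap, Function.update_of_ne hkd]
      change procHistory G.hist q = toHistory ((G.done q).map _) ++ (G.cur q).toList.map _
      rw [this]
      exact hG.proc_hist q }

theorem dequeued_swap {G : Run n} {d e v a : ℕ} :
    (G.swap d e v).Dequeued a ↔ G.Dequeued a ∨ a = e := by
  simp only [Dequeued, swap, List.map_append, List.mem_append, List.map_cons, List.map_nil,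
    List.mem_singleton]

theorem swapped_swap {G : Run n} {d e v a : ℕ} :
    (G.swap d e v).Swapped a ↔ G.Swapped a ∨ a = d := by
  simp only [Swapped, swap, List.map_append, List.mem_append, List.map_cons, List.map_nil,
    List.mem_singleton]

theorem QueueOK.swap {G : Run n} {c : (herlihyWing n).Config} (hG : G.HistOK)
    (hQ : G.QueueOK c) {p : Fin n} {d e v l j : ℕ} (hd : G.cur p = some d)
    (hinv : G.inv d = deqInv) (hns : ¬ G.Swapped d) (hjl : j < l) (hscan : G.Scanned l j)
    (he : G.idx e = some j) (hw : G.written e) (hne : ¬ G.Dequeued e) (hv : G.inv e = enqInv v) :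
    (G.swap d e v).QueueOK ⟨{ c.mem with Q := Function.update c.mem.Q j none },
      Function.update c.proc p (some (deqInv, .d4 v))⟩ := by
  have hspec := (hG.cur_spec p d).1 hd
  -- A predecessor `a` of `e` has returned, so it has written into a slot, which is smaller than
  -- `j`; the scan has passed that slot, and `e` itself is the later enqueue with slot below `l`
  -- that `Scanned` requires.
  have hclosed : ∀ a, G.Before a e → (∃ x, G.inv a = enqInv x) → G.Dequeued a := by
    rintro a hb ⟨x, hx⟩
    have hr : G.retTime a ≠ none := by
      obtain ⟨-, -, r, hr, -⟩ := hb
      simp [hr]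
    obtain ⟨i, hi⟩ := hQ.written_idx a (hQ.ret_written a hb.1 hr x hx)
    exact hscan a e i j hi (hQ.idx_mono a e i j hb hi he) he hjl hb
  exact
  { hQ with
    proc_none := fun q h => by
      by_cases hq : q = p
      · subst hq; simp at h
      · exact hQ.proc_none q (by simpa only [Function.update_of_ne hq] using h)
    proc_some := fun q i ℓ' h => by
      by_cases hq : q = p
      · subst hq
        simp only [Function.update_self, Option.some.injEq] at h
        obtain ⟨rfl, rfl⟩ := h
        exact ⟨d, hd, hinv, hinv, swapped_swap.2 (.inr rfl), Function.update_self _ _ _⟩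
      · obtain ⟨k', h1, h2, h3⟩ :=
          hQ.proc_some q i ℓ' (by simpa only [Function.update_of_ne hq] using h)
        refine ⟨k', h1, h2, ?_⟩
        have hkd := hG.ne_of_cur hq hd h1
        have hsw : ¬ G.Swapped k' → ¬ (G.swap d e v).Swapped k' := fun h h' =>
          (swapped_swap.1 h').elim h hkd
        cases ℓ'
        case d1 => exact ⟨h3.1, hsw h3.2⟩
        case d2 => exact ⟨h3.1, hsw h3.2.1, h3.2.2⟩
        case d3 =>
          obtain ⟨h4, h5, h6, h7, h8, h9⟩ := h3
          exact ⟨h4, hsw h5, h6, h7, h8, fun a a' i i' ha hi ha' hi' hb =>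
            dequeued_swap.2 (.inl (h9 a a' i i' ha hi ha' hi' hb))⟩
        case d4 x =>
          exact ⟨h3.1, swapped_swap.2 (.inl h3.2.1), by
            simpa [Run.swap, Function.update_of_ne hkd] using h3.2.2⟩
        all_goals exact h3
    ret_swapped := fun k h h' hk => swapped_swap.2 (.inl (hQ.ret_swapped k h h' hk))
    enq_res := fun k h x hx => by
      have hkd : k ≠ d := by
        rintro rfl
        simp only [Run.swap, hinv] at hx
        simp at hx
      simpa [Run.swap, Function.update_of_ne hkd] using hQ.enq_res k h x hx
    full := fun i x h => by
      by_cases hi : i = j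
      · subst hi; simp at h
      · simp only [Function.update_of_ne hi] at h
        obtain ⟨a, h1, h2, h3, h4⟩ := hQ.full i x h
        refine ⟨a, h1, h2, fun h' => (dequeued_swap.1 h').elim h3 ?_, h4⟩
        rintro rfl
        rw [he] at h1
        exact hi (Option.some.inj h1).symm
    slot := fun a i h h' h'' => by
      rw [dequeued_swap, not_or] at h''
      have hi : i ≠ j := by
        rintro rfl
        exact h''.2 (hQ.idx_inj a e i h he)
      simp only [Function.update_of_ne hi]
      exact hQ.slot a i h h' h''.1
    swap_spec := fun d' e' h => by
      rcases List.mem_append.1 h with h' | h'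
      · have hdd : d' ≠ d := by
          rintro rfl
          exact hns (List.mem_map_of_mem (f := Prod.fst) h')
        simpa [Run.swap, Function.update_of_ne hdd] using hQ.swap_spec d' e' h'
      · obtain ⟨rfl, rfl⟩ : d' = d ∧ e' = e := by simpa using h'
        refine ⟨hspec.1, hinv, hw, ⟨v, hv, Function.update_self _ _ _⟩, ?_⟩
        simp only [Run.swap, Function.update_self]
        refine ⟨hG.call_lt _ (hQ.idx_spec _ _ he).1, hG.call_lt _ hspec.1, le_rfl, ?_⟩
        simp [hspec.2.2]
    swapped_nodup := by
      simp only [Run.swap, List.map_append, List.map_cons, List.map_nil]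
      exact List.nodup_append.2 ⟨hQ.swapped_nodup, by simp, fun a ha b hb hab =>
        hns (by rw [← List.mem_singleton.1 hb, ← hab]; exact ha)⟩
    dequeued_nodup := by
      simp only [Run.swap, List.map_append, List.map_cons, List.map_nil]
      exact List.nodup_append.2 ⟨hQ.dequeued_nodup, by simp, fun a ha b hb hab =>
        hne (by rw [← List.mem_singleton.1 hb, ← hab]; exact ha)⟩
    swaps_sorted := by
      simp only [Run.swap, List.map_append, List.map_cons, List.map_nil]
      have hswapped : ∀ a, G.Swapped a → a ≠ d := by
        rintro a ha rfl
        exact hns ha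
      refine List.pairwise_append.2 ⟨hQ.swaps_sorted.imp_of_mem ?_, by simp, ?_⟩
      · intro a b ha hb hab
        rwa [Function.update_of_ne (hswapped a ha), Function.update_of_ne (hswapped b hb)]
      · intro a ha b hb
        rw [List.mem_singleton.1 hb, Function.update_self,
          Function.update_of_ne (hswapped a ha)]
        exact (hQ.swapped_spec ha).2.2.2.2.1
    order := by
      simp only [Run.swap, List.map_append, List.map_cons, List.map_nil]
      refine List.pairwise_append.2 ⟨hQ.order, by simp, ?_⟩
      intro a ha b hb h
      rw [List.mem_singleton.1 hb] at h
      exact hne (hQ.closed e a ha h ⟨v, hv⟩)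
    closed := fun a b hb h hx => by
      refine dequeued_swap.2 (.inl ?_)
      rcases dequeued_swap.1 hb with hb | rfl
      · exact hQ.closed a b hb h hx
      · exact hclosed a h hx }

/-- The two runs agree on the history, the pending calls and the responses of completed operations. -/
structure SameVisible (G G' : Run n) : Prop where
  hist : G'.hist = G.hist
  size : G'.size = G.size
  inv : G'.inv = G.inv
  retTime : G'.retTime = G.retTime
  cur : G'.cur = G.cur
  res : ∀ k, G.retTime k ≠ none → G'.res k = G.res k

theorem exists_internal {G : Run n} {c : (herlihyWing n).Config} (hG : G.HistOK)
    (hQ : G.QueueOK c) {p : Fin n} {i : queueSig.Inv} {ℓ ℓ' : HLoc} {μ' : HMem}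
    (hp : c.proc p = some (i, ℓ)) (hs : HStep i c.mem ℓ μ' ℓ') :
    ∃ G' : Run n, G'.HistOK ∧ G'.QueueOK ⟨μ', Function.update c.proc p (some (i, ℓ'))⟩ ∧
      SameVisible G G' := by
  obtain ⟨k, hk, hi, hloc⟩ := hQ.proc_some p i ℓ hp
  have hsame : SameVisible G G := ⟨rfl, rfl, rfl, rfl, rfl, fun _ _ => rfl⟩
  have hupd : ∀ j, c.mem.Q j = none → Function.update c.mem.Q j none = c.mem.Q := by
    intro j hj
    rw [← hj, Function.update_eq_self]
  -- An enqueue in slot `j` that precedes another one has returned, hence written; since the slot is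
  -- empty, its value has been removed.
  have hnext : ∀ l j, c.mem.Q j = none → G.Scanned l j → G.Scanned l (j + 1) := by
    intro l j hj hsc a a' b b' ha hb ha' hb' hab
    rcases Nat.lt_or_eq_of_le (Nat.le_of_lt_succ hb) with h | rfl
    · exact hsc a a' b b' ha h ha' hb' hab
    · by_contra hnd
      obtain ⟨v, hv⟩ := (hQ.idx_spec a b ha).2.2.2
      have hr : G.retTime a ≠ none := by
        obtain ⟨-, -, r, hr, -⟩ := hab
        simp [hr]
      exact hQ.slot a b ha (hQ.ret_written a hab.1 hr v hv) hnd hj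
  cases hs with
  | e1 v =>
    exact ⟨G.reserve k c.mem.X, hG.reserve _ _, hQ.reserve hG hk hi hloc.2,
      ⟨rfl, rfl, rfl, rfl, rfl, fun _ _ => rfl⟩⟩
  | e2 v _ j =>
    exact ⟨G.write k, hG.write _, hQ.write hG hk hi hloc.2.1 hloc.2.2,
      ⟨rfl, rfl, rfl, rfl, rfl, fun _ _ => rfl⟩⟩
  | d1 =>
    exact ⟨G, hG, hi ▸ hQ.setProc hk ⟨hloc.1, hloc.2, hQ.X_pos, le_rfl⟩, hsame⟩
  | d2Empty =>
    exact ⟨G, hG, hi ▸ hQ.setProc hk ⟨hloc.1, hloc.2.1⟩, hsame⟩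
  | d2 _ l hl =>
    refine ⟨G, hG, hi ▸ hQ.setProc hk ⟨hloc.1, hloc.2.1, le_rfl, ?_, hloc.2.2.2, ?_⟩, hsame⟩
    · have := hloc.2.2.1
      omega
    -- Slots start at 1, so nothing has to be scanned below `j = 1`.
    · intro a a' b b' ha hb
      have := (hQ.idx_spec a b ha).2.1
      omega
  | d3Found _ l j x hx =>
    obtain ⟨e, h1, h2, h3, h4⟩ := hQ.full j x hx
    have hr := ((hG.cur_spec p k).1 hk).2.2
    refine ⟨G.swap k e x, hG.swap hr _ _, hQ.swap hG hk hloc.1 hloc.2.1 hloc.2.2.2.1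
      hloc.2.2.2.2.2 h1 h2 h3 h4, ⟨rfl, rfl, rfl, rfl, rfl, ?_⟩⟩
    intro k' hk'
    refine Function.update_of_ne ?_ _ _
    rintro rfl
    exact hk' hr
  | d3Last _ l j hj hl =>
    rw [hupd j hj]
    exact ⟨G, hG, hi ▸ hQ.setProc hk ⟨hloc.1, hloc.2.1⟩, hsame⟩
  | d3Next _ l j hj hl =>
    rw [hupd j hj]
    obtain ⟨h1, h2, h3, h4, h5, h6⟩ := hloc
    exact ⟨G, hG, hi ▸ hQ.setProc hk ⟨h1, h2, by omega, by omega, h5, hnext l j hj h6⟩, hsame⟩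

end Run

/-! ### Solo executions -/

/-- Sequences of steps of a relation between pairs. -/
inductive Steps {M L : Type} (r : M → L → M → L → Prop) : M → L → M → L → Prop
  | refl (μ : M) (ℓ : L) : Steps r μ ℓ μ ℓ
  | head {μ μ' μ'' : M} {ℓ ℓ' ℓ'' : L} : r μ ℓ μ' ℓ' → Steps r μ' ℓ' μ'' ℓ'' → Steps r μ ℓ μ'' ℓ''

theorem Steps.trans {M L : Type} {r : M → L → M → L → Prop} {μ μ' μ'' : M} {ℓ ℓ' ℓ'' : L}
    (h : Steps r μ ℓ μ' ℓ') (h' : Steps r μ' ℓ' μ'' ℓ'') : Steps r μ ℓ μ'' ℓ'' := by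
  induction h with
  | refl => exact h'
  | head hs _ ih => exact .head hs (ih h')

theorem Steps.exists_path {S : Sig} {n : ℕ} {O : ConcObj S n} {p : Fin n} {inv : S.Inv}
    {μ μ' : O.Shared} {ℓ ℓ' : O.Loc} (h : Steps (O.step p inv) μ ℓ μ' ℓ') :
    ∀ f : Fin n → Option (S.Inv × O.Loc), f p = some (inv, ℓ) →
      ∃ ls, O.sem.Path ⟨μ, f⟩ ls ⟨μ', Function.update f p (some (inv, ℓ'))⟩ ∧
        ls.filterMap Label.visible = [] := by
  induction h with
  | refl μ ℓ =>
    intro f hf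
    refine ⟨[], ?_, rfl⟩
    rw [← hf, Function.update_eq_self]
    exact .nil _
  | @head μ μ₁ μ₂ ℓ ℓ₁ ℓ₂ hs _ ih =>
    intro f hf
    obtain ⟨ls, h1, h2⟩ := ih (Function.update f p (some (inv, ℓ₁))) (Function.update_self _ _ _)
    rw [Function.update_idem] at h1
    refine ⟨.internal p :: ls, ?_, by simpa [Label.visible] using h2⟩
    exact .cons (ConcObj.Step.internal ⟨μ, f⟩ p inv ℓ ℓ₁ μ₁ hf hs) h1

theorem ConcObj.step_ret_update {S : Sig} {n : ℕ} {O : ConcObj S n} {p : Fin n} {inv : S.Inv}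
    {μ : O.Shared} {f : Fin n → Option (S.Inv × O.Loc)} {ℓ : O.Loc} {b : S.Ret}
    (h : O.result ℓ = some b) :
    O.sem.step ⟨μ, Function.update f p (some (inv, ℓ))⟩ (.act (.ret p inv.1 b))
      ⟨μ, Function.update (Function.update f p (some (inv, ℓ))) p none⟩ :=
  ConcObj.Step.ret ⟨μ, Function.update f p (some (inv, ℓ))⟩ p inv ℓ b (Function.update_self _ _ _) h

section Universal

variable {S : Sig} {n : ℕ} {Spec : Set (List (Operation S))} {p : Fin n} {inv : S.Inv}

theorem steps_maxHead (μ : UMem S n) (oid : ℕ) : ∀ k, k + 1 ≤ n →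
    ∃ q : Fin n, Steps (UStep Spec p inv) μ (.maxHead oid 0 none) μ
      (.maxHead oid (k + 1) (some (μ.head q))) ∧
      ∀ q' : Fin n, (q' : ℕ) < k + 1 →
        (μ.heap (μ.head q')).seq ≤ (μ.heap (μ.head q)).seq
  | 0, hk => by
    refine ⟨⟨0, hk⟩, .head (UStep.maxHeadStep μ oid ⟨0, hk⟩ none) (.refl _ _), ?_⟩
    intro q' hq'
    obtain rfl : q' = ⟨0, hk⟩ := Fin.ext (by simpa using hq')
    exact le_rfl
  | k + 1, hk => by
    obtain ⟨q, h1, h2⟩ := steps_maxHead μ oid k (by omega)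
    have hs := UStep.maxHeadStep (Spec := Spec) (p := p) (inv := inv) μ oid ⟨k + 1, hk⟩
      (some (μ.head q))
    have hlast : ∀ q' : Fin n, (q' : ℕ) < k + 1 + 1 → (q' : ℕ) < k + 1 ∨ q' = ⟨k + 1, hk⟩ := by
      intro q' hq'
      rcases Nat.lt_or_eq_of_le (Nat.le_of_lt_succ hq') with h | h
      · exact .inl h
      · exact .inr (Fin.ext h)
    by_cases hlt : (μ.heap (μ.head q)).seq < (μ.heap (μ.head ⟨k + 1, hk⟩)).seq
    · simp only [if_pos hlt] at hs
      refine ⟨⟨k + 1, hk⟩, h1.trans (.head hs (.refl _ _)), ?_⟩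
      intro q' hq'
      rcases hlast q' hq' with h | rfl
      · exact (h2 q' h).trans hlt.le
      · exact le_rfl
    · simp only [if_neg hlt] at hs
      refine ⟨q, h1.trans (.head hs (.refl _ _)), ?_⟩
      intro q' hq'
      rcases hlast q' hq' with h | rfl
      · exact h2 q' h
      · exact not_lt.1 hlt

/-- The memory after the node at `aft` has been decided to follow the node at `bef` and its field
`hist` has been set. -/
def UMem.decided (μ : UMem S n) (bef aft : ℕ) : UMem S n :=
  (μ.set bef { μ.heap bef with decideNext := some aft }).set aft
    { μ.heap aft with hist := some μ.his }

/-- The memory after the node at `aft` has been appended to the node at `bef`. -/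
def UMem.linked (μ : UMem S n) (p : Fin n) (bef aft : ℕ) (l : List (TaggedOp S n)) : UMem S n :=
  { (μ.set bef { μ.heap bef with decideNext := some aft, next := some aft }).set aft
      { μ.heap aft with hist := some μ.his, lin := some l, seq := (μ.heap bef).seq + 1 } with
    head := Function.update μ.head p aft }

/-- A solo execution of the loop that appends the node announced by the process itself. -/
theorem steps_loop {μ : UMem S n} {oid bef : ℕ} {b : S.Ret} {l : List (TaggedOp S n)}
    (hbef : μ.head p = bef) (hne : μ.announce p ≠ bef)
    (hnew : μ.heap (μ.announce p) = Node.new (some (oid, inv)))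
    (hdec : (μ.heap bef).decideNext = none)
    (hhelp : ∀ q, (μ.heap (μ.announce q)).seq = 0 → μ.announce q = μ.announce p)
    (hlin : GenLin Spec (μ.decided bef (μ.announce p)) bef (μ.announce p) l)
    (hret : GetRetValue (μ.linked p bef (μ.announce p) l) oid b) :
    Steps (UStep Spec p inv) μ (.loop oid)
      { μ.linked p bef (μ.announce p) l with his := μ.his ++ [⟨.ret p inv.1 b, oid⟩] }
      (.ret b) := by
  subst hbef
  obtain ⟨aft, haft⟩ : ∃ aft, aft = μ.announce p := ⟨_, rfl⟩
  rw [← haft] at hne hnew hhelp hlin hret ⊢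
  have hne' : μ.head p ≠ aft := hne.symm
  refine .head (.loopEnter μ oid (by rw [← haft, hnew]; rfl)) ?_
  refine .head (.readBefore μ oid) ?_
  refine .head (.readHelp μ oid _) ?_
  -- Both branches propose the own node: help is given only to a node with sequence number 0, and by
  -- `hhelp` that is the own one.
  refine Steps.trans (μ' := μ) (ℓ' := .decide oid (μ.head p) aft) ?_ ?_
  · by_cases h : (μ.heap (μ.announce ⟨((μ.heap (μ.head p)).seq + 1) % n,
        Nat.mod_lt _ (Fin.pos p)⟩)).seq = 0
    · refine .head (.testHelpPos μ oid _ _ h) (.head (.preferHelp μ oid _ _) ?_)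
      rw [hhelp _ h]
      exact .refl _ _
    · refine .head (.testHelpNeg μ oid _ _ h) (.head (.preferOwn μ oid _) ?_)
      rw [← haft]
      exact .refl _ _
  refine .head (.decideFirst μ oid _ _ hdec) ?_
  refine .head (.readHis _ oid _ _) ?_
  refine .head (.casHistSucc _ oid _ _ _ ?_) ?_
  · simp [UMem.set, Function.update_of_ne hne, hnew, Node.new]
  have hd : UMem.set (μ.set (μ.head p) { μ.heap (μ.head p) with decideNext := some aft }) aft
      { (μ.set (μ.head p) { μ.heap (μ.head p) with decideNext := some aft }).heap aft with
        hist := some μ.his } = μ.decided (μ.head p) aft := by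
    simp [UMem.decided, UMem.set, Function.update_of_ne hne]
  refine Steps.trans (μ' := μ.decided (μ.head p) aft) (ℓ' := .genLin oid (μ.head p) aft)
    (hd ▸ .refl _ _) ?_
  refine .head (.genLin _ oid _ _ l hlin) ?_
  refine .head (.casLinSucc _ oid _ _ l ?_) ?_
  · simp [UMem.decided, UMem.set, hnew, Node.new]
  refine .head (.setNext _ oid _ _) ?_
  refine .head (.setSeq _ oid _ _) ?_
  refine .head (.setHead _ oid _) ?_
  refine Steps.trans (μ' := μ.linked p (μ.head p) aft l) (ℓ' := .loop oid) ?_ ?_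
  · convert Steps.refl _ _ using 1
    simp only [UMem.linked, UMem.decided, UMem.set, Function.update_self,
      Function.update_of_ne hne, Function.update_of_ne hne', Function.update_idem]
    congr 1
    funext a
    by_cases ha : a = aft
    · subst ha
      simp
    · by_cases ha' : a = μ.head p
      · subst ha'
        simp [Function.update_of_ne ha]
      · simp [Function.update_of_ne ha, Function.update_of_ne ha']
  -- The own node now has a positive sequence number, so one round suffices, and `head[pid]` already
  -- points to it.
  refine .head (.loopExit _ oid ?_) ?_
  · simp [UMem.linked, UMem.set, ← haft]
  refine .head (.finalHead _ oid) ?_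
  refine Steps.trans (μ' := μ.linked p (μ.head p) aft l) (ℓ' := .getRet oid) ?_ ?_
  · convert Steps.refl _ _ using 1
    simp [UMem.linked, UMem.set, ← haft]
  refine .head (.getRet _ oid b hret) ?_
  exact .head (.storeRet _ oid b) (.refl _ _)

end Universal

/-! ### The simulation -/

variable {n : ℕ}

/-- The universal object between two calls or returns: the nodes at the addresses below `nextAddr`
form the list, in this order, and carry the completed operations; every pending operation has been
recorded in the history but not yet announced. -/
structure Run.UnivOK (G : Run n) (c : (universal queueSpec n).Config) : Prop where
  his : c.mem.his = G.hist
  nextId : c.mem.nextId = G.size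
  proc : ∀ p, c.proc p = (G.cur p).map fun k => (G.inv k, ULoc.announce k)
  addr_pos : 0 < c.mem.nextAddr
  next_some : ∀ a, a + 1 < c.mem.nextAddr → (c.mem.heap a).next = some (a + 1)
  last : ∀ a, a + 1 = c.mem.nextAddr →
    (c.mem.heap a).next = none ∧ (c.mem.heap a).decideNext = none
  seq : ∀ a < c.mem.nextAddr, (c.mem.heap a).seq = a + 1
  node : ∀ a < c.mem.nextAddr, ∀ k i, (c.mem.heap a).op = some (k, i) →
    k < G.size ∧ G.retTime k ≠ none ∧ ∃ l, (c.mem.heap a).lin = some l ∧ HasRet l k (G.res k)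
  announce_lt : ∀ p, c.mem.announce p < c.mem.nextAddr
  head_lt : ∀ p, c.mem.head p < c.mem.nextAddr
  head_last : ∀ _ : Fin n, ∃ q, c.mem.head q + 1 = c.mem.nextAddr

namespace Run

/-- This is what lets the empty path match an internal step: the nodes of the list mention only
completed operations, whose responses no longer change. -/
theorem UnivOK.of_sameVisible {G G' : Run n} {c : (universal queueSpec n).Config}
    (hU : G.UnivOK c) (h : SameVisible G G') : G'.UnivOK c :=
  { hU with
    his := by rw [hU.his, h.hist]
    nextId := by rw [hU.nextId, h.size]
    proc := by rw [h.cur, h.inv]; exact hU.proc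
    node := fun a ha k i hk => by
      obtain ⟨h1, h2, h3⟩ := hU.node a ha k i hk
      rw [h.size, h.retTime, h.res k h2]
      exact ⟨h1, h2, h3⟩ }

/-- The call must be recorded at once, for later linearizations have to see its place in real time.
Stopping before the announcement keeps the operation out of reach of helpers. -/
theorem UnivOK.exists_call {G : Run n} {c : (universal queueSpec n).Config} (hG : G.HistOK)
    (hU : G.UnivOK c) {p : Fin n} (i : queueSig.Inv) (hp : G.cur p = none) :
    ∃ ls c', (universal queueSpec n).sem.Path c ls c' ∧
      ls.filterMap Label.visible = [.call p i] ∧ (G.addCall p i).UnivOK c' := by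
  obtain ⟨μ, f⟩ := c
  have hf : f p = none := by
    rw [show f p = _ from hU.proc p, hp]
    rfl
  have hsteps : Steps ((universal queueSpec n).step p i) μ ULoc.genId
      { μ with nextId := μ.nextId + 1, his := μ.his ++ [⟨.call p i, μ.nextId⟩] }
      (.announce μ.nextId) :=
    .head (UStep.genId μ) (.head (UStep.storeCall _ _) (.refl _ _))
  obtain ⟨ls, h1, h2⟩ := hsteps.exists_path (Function.update f p (some (i, ULoc.genId)))
    (Function.update_self _ _ _)
  refine ⟨.act (.call p i) :: ls, _,
    .cons (ConcObj.Step.call (O := universal queueSpec n) ⟨μ, f⟩ p i hf) h1,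
    by simpa [Label.visible] using h2, ?_⟩
  exact
  { hU with
    his := by
      change μ.his ++ [_] = G.hist ++ [_]
      rw [show μ.his = G.hist from hU.his, show μ.nextId = G.size from hU.nextId]
    nextId := congrArg (· + 1) hU.nextId
    proc := fun q => by
      change Function.update (Function.update f p _) p _ q =
        (Function.update G.cur p (some G.size) q).map fun k =>
          (Function.update G.inv G.size i k, ULoc.announce k)
      by_cases hq : q = p
      · subst hq
        simp [show μ.nextId = G.size from hU.nextId]
        rfl
      · simp only [Function.update_of_ne hq]
        rw [show f q = _ from hU.proc q]
        refine Option.map_congr fun k hk => ?_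
        rw [Function.update_of_ne (Nat.ne_of_lt ((hG.cur_spec q k).1 hk).1)]
    node := fun a ha k j hk => by
      obtain ⟨h3, h4, h5⟩ := hU.node a ha k j hk
      simp only [Run.addCall, Function.update_of_ne (Nat.ne_of_lt h3)]
      exact ⟨Nat.lt_succ_of_lt h3, h4, h5⟩ }

/-- The memories `μ₁` and `μ₂` are those after the announcement and after the computation of the
maximal head. The given `l` is admissible for `genLin` because `hdone` makes it agree with every
response already stored in the list. -/
theorem UnivOK.exists_ret {G : Run n} {c : (universal queueSpec n).Config} (hG : G.HistOK)
    (hU : G.UnivOK c) {p : Fin n} {k : ℕ} (hk : G.cur p = some k) {l : List (TaggedOp queueSig n)}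
    (hl : IsLinearization queueSpec G.hist l)
    (hdone : ∀ j < G.size, G.retTime j ≠ none → HasRet l j (G.res j))
    (hres : HasRet l k (G.res k)) :
    ∃ ls c', (universal queueSpec n).sem.Path c ls c' ∧
      ls.filterMap Label.visible = [.ret p (G.inv k).1 (G.res k)] ∧ (G.addRet p k).UnivOK c' := by
  obtain ⟨μ, f⟩ := c
  obtain ⟨hk1, hk2, hk3⟩ := (hG.cur_spec p k).1 hk
  have hf : f p = some (G.inv k, ULoc.announce k) := by simpa [hk] using hU.proc p
  obtain ⟨bef, hbef⟩ : ∃ bef, bef + 1 = μ.nextAddr :=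
    ⟨μ.nextAddr - 1, Nat.sub_add_cancel hU.addr_pos⟩
  have hU_next : ∀ a < bef, (μ.heap a).next = some (a + 1) := fun a ha =>
    hU.next_some a (by change a + 1 < μ.nextAddr; omega)
  have hU_seq : ∀ a, a ≤ bef → (μ.heap a).seq = a + 1 := fun a ha =>
    hU.seq a (by change a < μ.nextAddr; omega)
  have hU_head : ∀ q, μ.head q ≤ bef := fun q => by
    have : μ.head q < μ.nextAddr := hU.head_lt q
    omega
  have hU_ann : ∀ q, μ.announce q ≤ bef := fun q => by
    have : μ.announce q < μ.nextAddr := hU.announce_lt q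
    omega
  have hU_last := hU.last bef hbef
  have hU_node : ∀ a, a ≤ bef → ∀ j i, (μ.heap a).op = some (j, i) →
      j < G.size ∧ G.retTime j ≠ none ∧
        ∃ l, (μ.heap a).lin = some l ∧ HasRet l j (G.res j) := fun a ha =>
    hU.node a (by change a < μ.nextAddr; omega)
  have hhis : μ.his = G.hist := hU.his
  obtain ⟨μ₁, hμ₁⟩ : ∃ μ₁ : UMem queueSig n, μ₁ =
    { μ.set (bef + 1) (Node.new (some (k, G.inv k))) with
      nextAddr := bef + 1 + 1
      announce := Function.update μ.announce p (bef + 1) } := ⟨_, rfl⟩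
  have hheap₁ : ∀ a, a ≤ bef → μ₁.heap a = μ.heap a := by
    intro a ha
    rw [hμ₁]
    exact Function.update_of_ne (by omega) _ _
  have hnew₁ : μ₁.heap (bef + 1) = Node.new (some (k, G.inv k)) := by
    rw [hμ₁]
    exact Function.update_self _ _ _
  have hs₁ : Steps (UStep queueSpec p (G.inv k)) μ (.announce k) μ₁ (.maxHead k 0 none) := by
    have := UStep.announce (Spec := queueSpec) (p := p) (inv := G.inv k) μ k
    rw [← hbef, ← hμ₁] at this
    exact .head this (.refl _ _)
  have hhead₁ : μ₁.head = μ.head := by rw [hμ₁]; rfl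
  obtain ⟨μ₂, hμ₂⟩ : ∃ μ₂ : UMem queueSig n, μ₂ =
    { μ₁ with head := Function.update μ.head p bef } := ⟨_, rfl⟩
  have hs₂ : Steps (UStep queueSpec p (G.inv k)) μ₁ (.maxHead k 0 none) μ₂ (.loop k) := by
    -- All `n` entries are read, so the index of the last one is `n - 1`. The sequence number of a
    -- listed node is its address plus one, and some entry of `head` is the last node; hence the
    -- maximum found is `bef`.
    obtain ⟨q, h1, h2⟩ := steps_maxHead (Spec := queueSpec) (p := p) (inv := G.inv k) μ₁ k (n - 1)
      (by have := Fin.pos p; omega)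
    rw [Nat.sub_add_cancel (Fin.pos p)] at h1
    obtain ⟨q', hq'⟩ := hU.head_last p
    have hq'' : μ.head q' = bef := by
      have : μ.head q' + 1 = μ.nextAddr := hq'
      omega
    have h3 := h2 q' (by omega)
    rw [hhead₁, hheap₁ _ (hU_head _), hheap₁ _ (hU_head _), hU_seq _ (hU_head _),
      hU_seq _ (hU_head _), hq''] at h3
    have h4 : μ.head q = bef := by
      have := hU_head q
      omega
    rw [hhead₁, h4] at h1
    have h5 := UStep.maxHeadDone (Spec := queueSpec) (p := p) (inv := G.inv k) μ₁ k bef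
    rw [hhead₁, ← hμ₂] at h5
    exact h1.trans (.head h5 (.refl _ _))
  have hheap₂ : μ₂.heap = μ₁.heap := by rw [hμ₂]
  have hann : μ₂.announce p = bef + 1 := by
    rw [hμ₂, hμ₁]
    exact Function.update_self _ _ _
  have hann' : ∀ q, q ≠ p → μ₂.announce q = μ.announce q := by
    intro q hq
    rw [hμ₂, hμ₁]
    exact Function.update_of_ne hq _ _
  have hhis₂ : μ₂.his = G.hist := by rw [hμ₂, hμ₁]; exact hhis
  have hne : bef ≠ bef + 1 := by omega
  have hdecided : ∀ a, a ≤ bef → ((μ₂.decided bef (bef + 1)).heap a).next = (μ.heap a).next ∧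
      ((μ₂.decided bef (bef + 1)).heap a).op = (μ.heap a).op ∧
      ((μ₂.decided bef (bef + 1)).heap a).lin = (μ.heap a).lin := by
    intro a ha
    have ha' : a ≠ bef + 1 := by omega
    simp only [UMem.decided, UMem.set, Function.update_of_ne ha', hheap₂]
    by_cases hab : a = bef
    · subst hab
      simp [hheap₁]
    · simp [Function.update_of_ne hab, hheap₁ a ha]
  have hlinked : ∀ a < bef, (μ₂.linked p bef (bef + 1) l).heap a = μ.heap a := by
    intro a ha
    have ha' : a ≠ bef + 1 := by omega
    have ha'' : a ≠ bef := by omega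
    simp [UMem.linked, UMem.set, Function.update_of_ne ha', Function.update_of_ne ha'', hheap₂,
      hheap₁ a ha.le]
  have hlinked_bef : (μ₂.linked p bef (bef + 1) l).heap bef =
      { μ.heap bef with decideNext := some (bef + 1), next := some (bef + 1) } := by
    simp [UMem.linked, UMem.set, hheap₂, hheap₁ bef le_rfl]
  have hlinked_new : (μ₂.linked p bef (bef + 1) l).heap (bef + 1) =
      { (Node.new (some (k, G.inv k)) : Node queueSig n) with
        hist := some G.hist, lin := some l, seq := bef + 1 + 1 } := by
    simp [UMem.linked, UMem.set, hheap₂, hheap₁ bef le_rfl, hnew₁, hhis₂, hU_seq bef le_rfl]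
  -- At this moment the new node is decided but not linked: the `next` field of `bef` is still null,
  -- so only old nodes are reachable.
  have hreach_le : ∀ a, (μ₂.decided bef (bef + 1)).Reach tailAddr a → a ≤ bef := by
    intro a ha
    induction ha with
    | refl => exact Nat.zero_le _
    | @tail x y _ hxy hx =>
      rw [(hdecided x hx).1] at hxy
      rcases Nat.lt_or_eq_of_le hx with hx | rfl
      · rw [hU_next x hx] at hxy
        have := Option.some.inj hxy
        omega
      · rw [show (μ.heap x).next = none from hU_last.1] at hxy
        cases hxy
  have hgen : GenLin queueSpec (μ₂.decided bef (bef + 1)) bef (bef + 1) l := by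
    refine ⟨⟨G.hist, ?_, hl⟩, ⟨k, G.inv k, G.res k, ?_, hres⟩, ?_⟩
    · simp [UMem.decided, UMem.set, hhis₂]
    · simp [UMem.decided, UMem.set, hheap₂, hnew₁, Node.new]
    · intro a ha _ j i hj
      have hle := hreach_le a ha
      rw [(hdecided a hle).2.1] at hj
      obtain ⟨h1, h2, l', h3, h4⟩ := hU_node a hle j i hj
      exact ⟨l', G.res j, (hdecided a hle).2.2.trans h3, h4, hdone j h1 h2⟩
  have hreach : ∀ a, a ≤ bef + 1 → (μ₂.linked p bef (bef + 1) l).Reach tailAddr a := by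
    intro a
    induction a with
    | zero => exact fun _ => .refl
    | succ a ih =>
      intro ha
      refine (ih (by omega)).tail ?_
      rcases Nat.lt_or_eq_of_le (Nat.le_of_succ_le_succ ha) with h | rfl
      · rw [hlinked a h, hU_next a h]
      · rw [hlinked_bef]
  have hget : GetRetValue (μ₂.linked p bef (bef + 1) l) k (G.res k) :=
    ⟨bef + 1, G.inv k, l, hreach _ le_rfl, by rw [hlinked_new]; rfl, by rw [hlinked_new], hres⟩
  have hs₃ := steps_loop (Spec := queueSpec) (p := p) (inv := G.inv k) (μ := μ₂) (oid := k)
    (bef := bef) (b := G.res k) (l := l) (by rw [hμ₂]; exact Function.update_self _ _ _)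
    (by rw [hann]; exact hne.symm) (by rw [hann, hheap₂, hnew₁])
    (by rw [hheap₂, hheap₁ bef le_rfl]; exact hU_last.2)
    (by
      intro q hq
      by_cases hqp : q = p
      · rw [hqp]
      · rw [hann' q hqp, hheap₂, hheap₁ _ (hU_ann q), hU_seq _ (hU_ann q)] at hq
        omega)
    (by rw [hann]; exact hgen) (by rw [hann]; exact hget)
  rw [hann, hhis₂] at hs₃
  obtain ⟨ls, h1, h2⟩ := Steps.exists_path (O := universal queueSpec n)
    ((hs₁.trans hs₂).trans hs₃) f hf
  refine ⟨ls ++ [.act (.ret p (G.inv k).1 (G.res k))], _, h1.append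
    (.cons (ConcObj.step_ret_update (O := universal queueSpec n) rfl) (.nil _)),
    by simp [List.filterMap_append, h2, Label.visible], ?_⟩
  have haddr : (μ₂.linked p bef (bef + 1) l).nextAddr = bef + 1 + 1 := by
    rw [UMem.linked, hμ₂, hμ₁]; rfl
  exact
  { his := by
      change G.hist ++ [_] = G.hist ++ [_]
      simp [op, TaggedOp.retEvent, hk2]
    nextId := by
      have : μ.nextId = G.size := hU.nextId
      change (μ₂.linked p bef (bef + 1) l).nextId = G.size
      rw [UMem.linked, hμ₂, hμ₁]
      exact this
    proc := fun q => by
      change Function.update (Function.update f p _) p none q =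
        (Function.update G.cur p none q).map fun k => (G.inv k, ULoc.announce k)
      by_cases hq : q = p
      · subst hq
        simp only [Function.update_self]
        rfl
      · simp only [Function.update_of_ne hq]
        exact hU.proc q
    addr_pos := by
      change 0 < (μ₂.linked p bef (bef + 1) l).nextAddr
      omega
    next_some := fun a ha => by
      change a + 1 < (μ₂.linked p bef (bef + 1) l).nextAddr at ha
      change ((μ₂.linked p bef (bef + 1) l).heap a).next = _
      rcases Nat.lt_or_eq_of_le (show a ≤ bef by omega) with h | rfl
      · rw [hlinked a h, hU_next a h]
      · rw [hlinked_bef]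
    last := fun a ha => by
      change a + 1 = (μ₂.linked p bef (bef + 1) l).nextAddr at ha
      obtain rfl : a = bef + 1 := by omega
      change ((μ₂.linked p bef (bef + 1) l).heap _).next = _ ∧
        ((μ₂.linked p bef (bef + 1) l).heap _).decideNext = _
      rw [hlinked_new]
      exact ⟨rfl, rfl⟩
    seq := fun a ha => by
      change a < (μ₂.linked p bef (bef + 1) l).nextAddr at ha
      change ((μ₂.linked p bef (bef + 1) l).heap a).seq = _
      rcases Nat.lt_trichotomy a bef with h | rfl | h
      · rw [hlinked a h, hU_seq a h.le]
      · rw [hlinked_bef]; exact hU_seq _ le_rfl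
      · obtain rfl : a = bef + 1 := by omega
        rw [hlinked_new]
    node := fun a ha j i hj => by
      change a < (μ₂.linked p bef (bef + 1) l).nextAddr at ha
      change ((μ₂.linked p bef (bef + 1) l).heap a).op = _ at hj
      change j < G.size ∧ Function.update G.retTime k _ j ≠ none ∧
        ∃ l', ((μ₂.linked p bef (bef + 1) l).heap a).lin = some l' ∧ HasRet l' j (G.res j)
      have hret : ∀ j, G.retTime j ≠ none →
          Function.update G.retTime k (some G.hist.length) j ≠ none := by
        intro j hj
        by_cases hjk : j = k
        · subst hjk; simp
        · rwa [Function.update_of_ne hjk]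
      rcases Nat.lt_trichotomy a bef with h | rfl | h
      · rw [hlinked a h] at hj ⊢
        obtain ⟨h1, h2, h3⟩ := hU_node a h.le j i hj
        exact ⟨h1, hret j h2, h3⟩
      · rw [hlinked_bef] at hj ⊢
        obtain ⟨h1, h2, h3⟩ := hU_node a le_rfl j i hj
        exact ⟨h1, hret j h2, h3⟩
      · obtain rfl : a = bef + 1 := by omega
        rw [hlinked_new] at hj ⊢
        obtain ⟨rfl, -⟩ : k = j ∧ G.inv k = i := by simpa [Node.new] using hj
        exact ⟨hk1, by simp, l, rfl, hres⟩
    announce_lt := fun q => by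
      change (μ₂.linked p bef (bef + 1) l).announce q < (μ₂.linked p bef (bef + 1) l).nextAddr
      rw [haddr]
      change μ₂.announce q < _
      by_cases hq : q = p
      · rw [hq, hann]; omega
      · rw [hann' q hq]
        have := hU_ann q
        omega
    head_lt := fun q => by
      change Function.update μ₂.head p (bef + 1) q < (μ₂.linked p bef (bef + 1) l).nextAddr
      rw [haddr]
      by_cases hq : q = p
      · rw [hq, Function.update_self]; omega
      · have := hU_head q
        rw [Function.update_of_ne hq, hμ₂]
        simp only [Function.update_of_ne hq]
        omega
    head_last := fun _ => ⟨p, by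
      change Function.update μ₂.head p (bef + 1) p + 1 = (μ₂.linked p bef (bef + 1) l).nextAddr
      rw [haddr, Function.update_self]⟩ }

end Run

/-- The simulation relation. -/
def Simulates (c₁ : (herlihyWing n).Config) (c₂ : (universal queueSpec n).Config) : Prop :=
  ∃ G : Run n, G.HistOK ∧ G.QueueOK c₁ ∧ G.UnivOK c₂

/-- The empty run. -/
def Run.empty (p₀ : Fin n) : Run n where
  hist := []
  size := 0
  pid _ := p₀
  inv _ := deqInv
  res _ := .ack
  callTime _ := 0
  retTime _ := none
  cur _ := none
  done _ := []
  idx _ := none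
  written _ := False
  swaps := []
  swapTime _ := 0

theorem simulates_init (p₀ : Fin n) :
    Simulates (herlihyWing n).sem.init (universal queueSpec n).sem.init := by
  refine ⟨Run.empty p₀, ?_, ?_, ?_⟩
  · constructor <;> simp [Run.empty, procHistory, toHistory, HappensBefore]
  · constructor <;> simp [Run.empty, ConcObj.sem, herlihyWing, Run.Before, Run.Dequeued]
  · constructor <;> simp [Run.empty, ConcObj.sem, universal, UMem.init, tailAddr, Node.new]
    exact fun _ => ⟨p₀⟩

theorem isForwardSim_simulates (p₀ : Fin n) :
    IsForwardSim Label.visible (herlihyWing n).sem (universal queueSpec n).sem Simulates where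
  init := simulates_init p₀
  step := by
    rintro c₁ c₂ α c₁' ⟨G, hG, hQ, hU⟩ hs
    cases hs with
    | call p i hp =>
      have hcur := hQ.proc_none p hp
      obtain ⟨ls, c₂', h1, h2, h3⟩ := hU.exists_call hG i hcur
      exact ⟨ls, c₂', h1, h2, _, hG.addCall i hcur, hQ.addCall hG i hcur, h3⟩
    | internal p i ℓ ℓ' μ' hp hs =>
      obtain ⟨G', h1, h2, h3⟩ := Run.exists_internal hG hQ hp hs
      exact ⟨[], c₂, .nil _, rfl, G', h1, h2, hU.of_sameVisible h3⟩
    | ret p i ℓ b hp hb =>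
      obtain ⟨k, hk, rfl, hloc⟩ := hQ.proc_some p i ℓ hp
      obtain ⟨hlt, -, -⟩ := (hG.cur_spec p k).1 hk
      -- A return statement is reached only after the write of an enqueue or the successful swap of
      -- a dequeue, so the returning operation is resolved with response `b`.
      obtain ⟨hres, hw, hsw⟩ : G.res k = b ∧ (∀ v, G.inv k = enqInv v → G.written k) ∧
          (G.inv k = deqInv → G.Swapped k) := by
        cases ℓ <;> simp only [herlihyWing, HLoc.result, reduceCtorEq, Option.some.injEq] at hb
        case e3 =>
          obtain ⟨⟨v, hv⟩, hw⟩ := hloc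
          refine ⟨hb ▸ hQ.enq_res k hlt v hv, fun _ _ => hw, fun h => ?_⟩
          rw [hv] at h
          simp at h
        case d4 x =>
          obtain ⟨hv, hsw, hr⟩ := hloc
          refine ⟨hb ▸ hr, fun v h => ?_, fun _ => hsw⟩
          rw [hv] at h
          simp at h
      subst hres
      obtain ⟨l, hl, hret⟩ := Run.exists_linearization hG hQ
      obtain ⟨ls, c₂', h1, h2, h3⟩ := hU.exists_ret hG hk hl
        (fun j hj hr => hret j hj ((G.inv_cases j).imp id (hQ.ret_swapped j hj hr)))
        (hret k hlt ((G.inv_cases k).imp id hsw))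
      exact ⟨ls, c₂', h1, h2, _, hG.addRet hk, hQ.addRet hG hk hw hsw, h3⟩

end HWSim

theorem theorem6 (n : ℕ) :
    HWSim.SimulatedBy (HWSim.herlihyWing n) (HWSim.universal HWSim.queueSpec n) := by
  -- Without processes there are no transitions. Otherwise some process serves as the default value
  -- of `pid` in the empty run.
  rcases Nat.eq_zero_or_pos n with rfl | hn
  · refine ⟨fun _ _ => True, trivial, ?_⟩
    intro c₁ c₂ α c₁' _ hs
    cases hs with
    | call p => exact p.elim0
    | internal p => exact p.elim0
    | ret p => exact p.elim0
  · exact ⟨_, HWSim.isForwardSim_simulates ⟨0, hn⟩⟩
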